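/- Let $d \ge 2$ be an integer and let $\mathbb T_d$ be the infinite rooted tree in which every vertex, including the root, has exactly $d$ children. For $p \in [0,1]$, a $p$-biased random walk on $\mathbb T_d$ moves, at each step from a non-root vertex, to the parent of its current vertex with probability $p$ and to a uniformly chosen child of it with probability $1-p$; from the root it always moves to a uniformly chosen child of the root. The frog model $\mathrm{FM}(d,p)$ is the following process in discrete time. Initially there is one awake frog at the root and one sleeping frog at every other vertex. At each unit of time every awake frog makes one step of a $p$-biased random walk, and the walks of different frogs are independent. Whenever an awake frog arrives at a vertex that holds a sleeping frog, that sleeping frog wakes up and begins its own independent $p$-biased random walk from that vertex. Let $V(d,p)$ be the total number of visits of awake frogs to the root. The process $\mathrm{FM}(d,p)$ is called recurrent if $V(d,p) = \infty$ almost surely. **Theorem.** For every $d \ge 2$, the set of $p \in [0,1]$ for which $\mathrm{FM}(d,p)$ is recurrent is non-empty, and the critical drift $$p_d = \inf\{\, p \in [0,1] : \mathrm{FM}(d,p) \text{ is recurrent} \,\}$$ satisfies $$p_d \le 0.4155 .$$ -/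

import Mathlib

open MeasureTheory ProbabilityTheory

namespace FrogModel

/-- Vertices of the rooted `d`-ary tree: a vertex is the list of child labels on its path from the
root, the most recent label first. The root is `[]`, the children of `v` are `i :: v` for
`i : Fin d`, and the parent of a non-root vertex `v` is `v.tail`. -/
abbrev Vertex (d : ℕ) : Type := List (Fin d)

/-- The randomness behind one step of a walk: `true` means "move towards the root", `false` means
"move away from the root"; the second component is the child that is chosen if the walk
moves away. -/
abbrev Instruction (d : ℕ) : Type := Bool × Fin d

/-- The randomness of the model: `ω (v, n)` drives the step from time `n` to time `n + 1` of the
walk of the frog whose initial site is `v`. Time is counted from the waking of that frog. -/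
abbrev Environment (d : ℕ) : Type := Vertex d × ℕ → Instruction d

/-- One step of the walk from the vertex `v`: the root has no parent, so a frog there always moves
to the chosen child. -/
def step {d : ℕ} (v : Vertex d) (a : Instruction d) : Vertex d :=
  if v ≠ [] ∧ a.1 = true then v.tail else a.2 :: v

/-- The position, `n` steps after its waking, of the frog whose initial site is `v`. -/
def walk {d : ℕ} (ω : Environment d) (v : Vertex d) : ℕ → Vertex d
  | 0 => v
  | n + 1 => step (walk ω v n) (ω (v, n))

open Classical in
/-- `age ω t v` is the state at time `t` of the frog whose initial site is `v`: `none` if it is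
asleep, and `some k` if it is awake and has made `k` steps so far. At time `0` only the frog at the
root is awake. In each unit of time all awake frogs make one step, and a sleeping frog wakes up
when an awake frog arrives at its site. -/
noncomputable def age {d : ℕ} (ω : Environment d) : ℕ → Vertex d → Option ℕ
  | 0, v => if v = [] then some 0 else none
  | t + 1, v =>
    match age ω t v with
    | some k => some (k + 1)
    | none =>
      if ∃ u k, age ω t u = some k ∧ walk ω u (k + 1) = v then some 0 else none

/-- The total number of visits of awake frogs to the root: the number of pairs of a frog and a time
such that the frog is awake and at the root at that time. -/
noncomputable def rootVisits {d : ℕ} (ω : Environment d) : ℕ∞ :=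
  Set.encard {x : Vertex d × ℕ | ∃ k, age ω x.2 x.1 = some k ∧ walk ω x.1 k = []}

/-- The law of one instruction: "towards the root" with probability `p`, and an independent
uniformly distributed child. -/
noncomputable def instructionLaw (d : ℕ) [NeZero d] (p : unitInterval) :
    Measure (Instruction d) :=
  (bernoulliMeasure true false p).prod (PMF.uniformOfFintype (Fin d)).toMeasure

instance (d : ℕ) [NeZero d] (p : unitInterval) : IsProbabilityMeasure (instructionLaw d p) := by
  unfold instructionLaw; infer_instance

/-- The law of the environment: all instructions are independent with law `instructionLaw d p`. -/
noncomputable def environmentLaw (d : ℕ) [NeZero d] (p : unitInterval) :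
    Measure (Environment d) :=
  Measure.infinitePi fun _ : Vertex d × ℕ => instructionLaw d p

instance (d : ℕ) [NeZero d] (p : unitInterval) : IsProbabilityMeasure (environmentLaw d p) := by
  unfold environmentLaw; infer_instance

/-- The frog model on the `d`-ary tree with drift `p` is recurrent if the root is almost surely
visited infinitely often. -/
def IsRecurrent (d : ℕ) [NeZero d] (p : unitInterval) : Prop :=
  ∀ᵐ ω ∂(environmentLaw d p), rootVisits ω = ⊤

/-- The set of the drifts `p ∈ [0, 1]` for which the frog model is recurrent, as real numbers. -/
def recurrentDrifts (d : ℕ) [NeZero d] : Set ℝ :=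
  {p : ℝ | ∃ hp : p ∈ Set.Icc (0 : ℝ) 1, IsRecurrent d ⟨p, hp⟩}

/-- The critical drift, the infimum of the recurrent drifts. -/
noncomputable def criticalDrift (d : ℕ) [NeZero d] : ℝ :=
  sInf (recurrentDrifts d)

end FrogModel

/-! Recurrence is proved for the single drift `2 / 5`, for every `d ≥ 2`; since `2 / 5 ≤ 0.4155`,
this suffices.

Each frog is followed until it first hits a cutoff level `N`, and only the lowest level reached and
the hitting point are kept. These outcomes are independent over frogs. To bound the number of root
visits from below, only frogs in `activated` are counted: those met by following the root frog's
path to level `N` where, at each vertex `v` of the path, at most one frog passing through `v` is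
allowed to open a second child of `v`. The subtrees of distinct children use disjoint sets of frogs,
so the two explorations at `v` are independent.

A frog at a vertex `v` that is `n + 1` levels above the cutoff moves on to the parent of `v` with
probability `ρ = ruinProb (n + 1)`; otherwise it ends below a uniform child, hence below a second
child with probability at least `(1 - ρ) / 2`. This gives a recursion in `n` for the generating
function of the number of frogs leaving a subtree of height `n`. By induction it is bounded by that
of a geometric variable of mean `rate n`, which grows linearly (`genBound_step`,
`integral_leavingProd_le`). Giving weight `1 / 2` to every frog that reaches the root, Markov's
inequality yields `P(V < K) ≤ 2 ^ K * genBound (rate n) (1 / 2)`, and `n → ∞` gives `V ≥ K` almost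
surely for each `K`. -/

namespace FrogModel

/-! ### Ruin probabilities and the generating function inequality -/

/-- The probability that a walk with drift `2 / 5` reaches the parent of its initial vertex before
it gets `n` levels further down. -/
noncomputable def ruinProb : ℕ → ℝ
  | 0 => 0
  | n + 1 => 2 / (5 - 3 * ruinProb n)

lemma ruinProb_mem (n : ℕ) : 0 ≤ ruinProb n ∧ ruinProb n ≤ 2 / 3 := by
  induction n with
  | zero => norm_num [ruinProb]
  | succ n ih =>
    have h : 0 < 5 - 3 * ruinProb n := by linarith
    refine ⟨by rw [ruinProb]; positivity, ?_⟩
    rw [ruinProb, div_le_iff₀ h]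
    linarith

lemma ruinProb_succ_mul (n : ℕ) : ruinProb (n + 1) * (5 - 3 * ruinProb n) = 2 := by
  have := ruinProb_mem n
  rw [ruinProb, div_mul_cancel₀]
  linarith

/-- The values start `0, 2/5, 10/19, 38/65, 130/211`; the last is the first to reach `3 / 5`, and
the recursion then preserves the bound. This is the reason for the shift by `4` in `rate`. -/
lemma le_ruinProb (n : ℕ) : 3 / 5 ≤ ruinProb (n + 4) := by
  induction n with
  | zero => norm_num [ruinProb]
  | succ n ih =>
    have := ruinProb_mem (n + 4)
    rw [show n + 1 + 4 = n + 4 + 1 by ring, ruinProb, le_div_iff₀ (by linarith)]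
    linarith

/-- The parameter of the bound on the generating function of the number of frogs that leave a
subtree of height `n`. -/
noncomputable def rate (n : ℕ) : ℝ := (n - 4 : ℕ) / 10

lemma rate_nonneg (n : ℕ) : 0 ≤ rate n := by unfold rate; positivity

/-- The polynomial inequality behind `genBound_step`. -/
lemma genBound_poly {ρ u l : ℝ} (hρ : 3 / 5 ≤ ρ) (hρ' : ρ ≤ 2 / 3) (hu : 0 ≤ u) (hu' : u ≤ 1)
    (hl : 0 ≤ l) :
    ((1 - ρ * u) * (1 + l * ((1 - ρ) / 2 + ρ * u)) +
        (1 - ((1 - ρ) / 2 + ρ * u)) * (l * (ρ * u)) * (1 + l * (ρ * u))) *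
        (1 + (l + 1 / 10) * u) ≤
      (1 + l * (ρ * u)) ^ 2 * (1 + l * ((1 - ρ) / 2 + ρ * u)) := by
  obtain ⟨k, hk⟩ : ∃ k, k = ρ * u := ⟨_, rfl⟩
  obtain ⟨b, hb⟩ : ∃ b, b = (1 - ρ) / 2 + ρ * u := ⟨_, rfl⟩
  rw [← hb, ← hk]
  have hk0 : 0 ≤ k := by rw [hk]; positivity
  have hk1 : k ≤ 2 / 3 := by nlinarith
  have hb0 : 0 ≤ b := by linarith
  have hb1 : b ≤ 1 := by linarith
  have hρ1 : 0 ≤ 1 - ρ := by linarith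
  have hprod := mul_nonneg (sub_nonneg.2 hρ) (sub_nonneg.2 hρ')
  have c0 : 1 / 2 ≤ ρ - (1 - k) / 10 := by linarith
  have c1 : -(1 / 5) ≤ ρ + 2 * b * ρ - 1 + k - (b - 2 * k * b + k) / 10 := by
    have : 0 ≤ k * b := by positivity
    nlinarith [mul_nonneg hb0 (sub_nonneg.2 hρ)]
  -- Dropping the nonnegative term `b * k * k / 10` leaves a quadratic in `u`, whose coefficients
  -- are bounded separately.
  have c2 : 1 / 40 ≤ k * ρ * b + 2 * ρ * b - b - k + 2 * k * b - (1 - b) * k * k / 10 := by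
    have h1 : (1 - ρ) / 2 * (2 * ρ - 1) + u * (ρ * ((1 - ρ) / 2 * (2 + ρ) + 2 * ρ - 2)) +
        u ^ 2 * (ρ ^ 2 * (19 / 10 + ρ)) ≤
        k * ρ * b + 2 * ρ * b - b - k + 2 * k * b - (1 - b) * k * k / 10 := by
      have : 0 ≤ b * k * k := by positivity
      rw [hb, hk] at *
      nlinarith
    have h2 : 1 / 26 ≤ (1 - ρ) / 2 * (2 * ρ - 1) := by nlinarith
    have h3 : -(3 / 10) ≤ ρ * ((1 - ρ) / 2 * (2 + ρ) + 2 * ρ - 2) := by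
      nlinarith [mul_nonneg hprod (sub_nonneg.2 hρ), mul_nonneg hprod (sub_nonneg.2 hρ')]
    have h4 : 9 / 10 ≤ ρ ^ 2 * (19 / 10 + ρ) := by nlinarith
    nlinarith [sq_nonneg (u - 1 / 6), mul_nonneg hu (sub_nonneg.2 h3),
      mul_nonneg (sq_nonneg u) (sub_nonneg.2 h4)]
  have c3 : 0 ≤ k * ρ * (b - (1 - b) * u) := by
    have h1 : b - (1 - b) * u = (1 - ρ) / 2 * (1 - u) + ρ * u ^ 2 := by rw [hb]; ring
    have : 0 ≤ 1 - u := by linarith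
    rw [h1]
    positivity
  -- By `c0`, `c1`, `c2` this is at least `1/2 - l/5 + l²/40 = (l - 4)²/40 + 1/10`.
  have hq : 0 ≤ (ρ - (1 - k) / 10) + (ρ + 2 * b * ρ - 1 + k - (b - 2 * k * b + k) / 10) * l +
      (k * ρ * b + 2 * ρ * b - b - k + 2 * k * b - (1 - b) * k * k / 10) * l ^ 2 := by
    nlinarith [sq_nonneg (l - 4), mul_nonneg (sub_nonneg.2 c1) hl,
      mul_nonneg (sub_nonneg.2 c2) (sq_nonneg l)]
  -- The difference vanishes at `u = 0`; after removing the factor `u` it is a cubic in `l`.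
  have key : (1 + l * k) ^ 2 * (1 + l * b) -
      ((1 - k) * (1 + l * b) + (1 - b) * (l * k) * (1 + l * k)) * (1 + (l + 1 / 10) * u) =
      u * (((ρ - (1 - k) / 10) + (ρ + 2 * b * ρ - 1 + k - (b - 2 * k * b + k) / 10) * l +
        (k * ρ * b + 2 * ρ * b - b - k + 2 * k * b - (1 - b) * k * k / 10) * l ^ 2) +
        k * ρ * (b - (1 - b) * u) * l ^ 3) := by
    rw [hk]; ring
  have := mul_nonneg hu (add_nonneg hq (mul_nonneg c3 (pow_nonneg hl 3)))
  linarith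

/-- The generating function `m ↦ 1 / (1 + l (1 - m))` of a geometric variable of mean `l`. -/
noncomputable def genBound (l m : ℝ) : ℝ := (1 + l * (1 - m))⁻¹

lemma genBound_pos {l m : ℝ} (hl : 0 ≤ l) (hm : m ≤ 1) : 0 < genBound l m := by
  have : 0 ≤ l * (1 - m) := mul_nonneg hl (by linarith)
  unfold genBound
  positivity

lemma genBound_le_one {l m : ℝ} (hl : 0 ≤ l) (hm : m ≤ 1) : genBound l m ≤ 1 := by
  have : 0 ≤ l * (1 - m) := mul_nonneg hl (by linarith)
  exact inv_le_one_of_one_le₀ (by linarith)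

lemma genBound_mono {l m m' : ℝ} (hl : 0 ≤ l) (hm : m ≤ m') (hm' : m' ≤ 1) :
    genBound l m ≤ genBound l m' := by
  have : 0 ≤ l * (1 - m') := mul_nonneg hl (by linarith)
  exact inv_anti₀ (by linarith) (by nlinarith)

/-- The bound on the generating function improves with the height of the tree: a frog that comes
to the top vertex moves on to the parent with probability `ρ`, and otherwise it triggers the second
subtree with probability at least `(1 - ρ) / 2`. -/
lemma genBound_step {κ m : ℝ} (n : ℕ) (hκ : 0 ≤ κ) (hκ' : κ ≤ 1 / 2) (hm : 0 ≤ m) (hm' : m ≤ 1) :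
    (ruinProb (n + 1) * m + (1 - ruinProb (n + 1)) * κ) *
        genBound (rate n) (ruinProb (n + 1) * m + (1 - ruinProb (n + 1)) * κ) *
        (1 - genBound (rate n) (ruinProb (n + 1) * m + (1 - ruinProb (n + 1)))) +
      (ruinProb (n + 1) * m + (1 - ruinProb (n + 1))) *
        genBound (rate n) (ruinProb (n + 1) * m + (1 - ruinProb (n + 1))) *
        genBound (rate n) (ruinProb (n + 1) * m + (1 - ruinProb (n + 1))) ≤
      genBound (rate (n + 1)) m := by
  obtain ⟨hρ0, hρ1⟩ := ruinProb_mem (n + 1)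
  rcases lt_or_ge n 4 with hn | hn
  -- Truncated subtraction makes both rates zero here, so every `genBound` is `1` and nothing has to
  -- be gained.
  · have h0 : rate n = 0 := by simp [rate, show n - 4 = 0 by omega]
    have h1 : rate (n + 1) = 0 := by simp [rate, show n + 1 - 4 = 0 by omega]
    rw [h0, h1]
    simp only [genBound, zero_mul, add_zero, inv_one, mul_one, sub_self, mul_zero, zero_add]
    nlinarith
  · obtain ⟨k, rfl⟩ := Nat.exists_eq_add_of_le' hn
    have hρ2 := le_ruinProb (k + 1)
    rw [show k + 1 + 4 = k + 4 + 1 by ring] at hρ2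
    have hl := rate_nonneg (k + 4)
    have h1 : rate (k + 4 + 1) = rate (k + 4) + 1 / 10 := by
      simp [rate, show k + 4 + 1 - 4 = k + 1 by omega, add_div]
    rw [h1]
    generalize ruinProb (k + 4 + 1) = ρ at *
    generalize rate (k + 4) = l at *
    set y := ρ * m + (1 - ρ) with hy
    set z := ρ * m + (1 - ρ) / 2 with hz
    have hz0 : 0 ≤ z := by rw [hz]; have : 0 ≤ ρ * m := by positivity
                           linarith
    have hz1 : z ≤ 1 := by nlinarith
    have hy1 : y ≤ 1 := by nlinarith
    -- The worst case is `κ = 1 / 2`, the binary tree; the left side is monotone in `κ`.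
    have hwz : ρ * m + (1 - ρ) * κ ≤ z := by nlinarith
    have hw0 : 0 ≤ ρ * m + (1 - ρ) * κ := by
      have : 0 ≤ 1 - ρ := by linarith
      positivity
    have hgy := genBound_le_one hl hy1
    refine (add_le_add_left (mul_le_mul_of_nonneg_right (mul_le_mul hwz
      (genBound_mono hl hwz hz1) (genBound_pos hl (hwz.trans hz1)).le hz0)
      (sub_nonneg.2 hgy)) _).trans ?_
    have hpoly := genBound_poly hρ2 hρ1 (sub_nonneg.2 hm') (by linarith : 1 - m ≤ 1) hl
    have ey : 1 + l * (1 - y) = 1 + l * (ρ * (1 - m)) := by rw [hy]; ring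
    have ez : 1 + l * (1 - z) = 1 + l * ((1 - ρ) / 2 + ρ * (1 - m)) := by rw [hz]; ring
    have py : 0 < 1 + l * (1 - y) := by
      have : 0 ≤ l * (1 - y) := mul_nonneg hl (by linarith)
      linarith
    have pz : 0 < 1 + l * (1 - z) := by
      have : 0 ≤ l * (1 - z) := mul_nonneg hl (by linarith)
      linarith
    have pm : 0 < 1 + (l + 1 / 10) * (1 - m) := by
      have : 0 ≤ (l + 1 / 10) * (1 - m) := mul_nonneg (by linarith) (by linarith)
      linarith
    have e1 : z * genBound l z * (1 - genBound l y) + y * genBound l y * genBound l y =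
        (y * (1 + l * (1 - z)) + z * (l * (1 - y)) * (1 + l * (1 - y))) /
          ((1 + l * (1 - y)) ^ 2 * (1 + l * (1 - z))) := by
      unfold genBound
      field_simp
      ring
    rw [e1, genBound, ← one_div, div_le_div_iff₀ (by positivity) pm, one_mul]
    rw [ey, ez, show y = 1 - ρ * (1 - m) by rw [hy]; ring,
      show z = 1 - ((1 - ρ) / 2 + ρ * (1 - m)) by rw [hz]; ring, sub_sub_cancel]
    exact hpoly

/-! ### The outcome of a single walk -/

/-- The walk from `w` that is driven by the instructions `η`. -/
def path {d : ℕ} (η : ℕ → Instruction d) (w : Vertex d) : ℕ → Vertex d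
  | 0 => w
  | n + 1 => step (path η w n) (η n)

lemma walk_eq_path {d : ℕ} (ω : Environment d) (v : Vertex d) (n : ℕ) :
    walk ω v n = path (fun k => ω (v, k)) v n := by
  induction n with
  | zero => rfl
  | succ n ih => rw [walk, path, ih]

lemma path_shift {d : ℕ} (η : ℕ → Instruction d) (w : Vertex d) (n : ℕ) :
    path (fun k => η (k + 1)) (step w (η 0)) n = path η w (n + 1) := by
  induction n with
  | zero => rfl
  | succ n ih => rw [path, ih]; rfl

/-- What matters of the walk of a frog: `some (h, z)` if `z` is the first vertex of level `N` that
it visits and `h` is the lowest level up to then, and `none` if it never gets to level `N`. -/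
abbrev Outcome (d : ℕ) : Type := Option (ℕ × Vertex d)

instance (d : ℕ) : MeasurableSpace (Outcome d) := ⊤

instance (d : ℕ) : DiscreteMeasurableSpace (Outcome d) := ⟨fun _ => trivial⟩

/-- The outcome of the walk from `w` within `t` steps, where `h` is the lowest level so far. -/
def outcomeWithin {d : ℕ} (N : ℕ) : ℕ → ℕ → Vertex d → (ℕ → Instruction d) → Outcome d
  | 0, _, _, _ => none
  | t + 1, h, w, η =>
    if w.length = N then some (h, w)
    else outcomeWithin N t (min h (step w (η 0)).length) (step w (η 0)) fun k => η (k + 1)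

lemma outcomeWithin_succ {d N t h : ℕ} {w : Vertex d} {η : ℕ → Instruction d} {r : ℕ × Vertex d}
    (hr : outcomeWithin N t h w η = some r) : outcomeWithin N (t + 1) h w η = some r := by
  induction t generalizing h w η with
  | zero => simp [outcomeWithin] at hr
  | succ t ih =>
    rw [outcomeWithin] at hr ⊢
    split_ifs at hr ⊢
    · exact hr
    · exact ih hr

lemma outcomeWithin_mono {d N t t' h : ℕ} {w : Vertex d} {η : ℕ → Instruction d}
    {r : ℕ × Vertex d} (htt' : t ≤ t') (hr : outcomeWithin N t h w η = some r) :
    outcomeWithin N t' h w η = some r := by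
  induction t', htt' using Nat.le_induction with
  | base => exact hr
  | succ t' _ ih => exact outcomeWithin_succ ih

open Classical in
/-- The outcome of the walk from `w`, where `h` is the lowest level so far. -/
noncomputable def outcome {d : ℕ} (N h : ℕ) (w : Vertex d) (η : ℕ → Instruction d) : Outcome d :=
  if H : ∃ r t, outcomeWithin N t h w η = some r then some H.choose else none

lemma outcome_eq_some_iff {d N h : ℕ} {w : Vertex d} {η : ℕ → Instruction d} {r : ℕ × Vertex d} :
    outcome N h w η = some r ↔ ∃ t, outcomeWithin N t h w η = some r := by
  unfold outcome
  split_ifs with H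
  · obtain ⟨t, ht⟩ := H.choose_spec
    rw [Option.some_inj]
    refine ⟨fun h => ⟨t, h ▸ ht⟩, fun ⟨t', ht'⟩ => ?_⟩
    have h1 := outcomeWithin_mono (le_max_left t t') ht
    rw [outcomeWithin_mono (le_max_right t t') ht'] at h1
    exact (Option.some_inj.1 h1).symm
  · exact ⟨fun h => by simp at h, fun ⟨t, ht⟩ => (H ⟨r, t, ht⟩).elim⟩

lemma outcome_of_length_eq {d N h : ℕ} {w : Vertex d} {η : ℕ → Instruction d}
    (hw : w.length = N) : outcome N h w η = some (h, w) :=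
  outcome_eq_some_iff.2 ⟨1, by rw [outcomeWithin, if_pos hw]⟩

lemma outcome_of_length_ne {d N h : ℕ} {w : Vertex d} {η : ℕ → Instruction d}
    (hw : w.length ≠ N) : outcome N h w η =
      outcome N (min h (step w (η 0)).length) (step w (η 0)) fun k => η (k + 1) := by
  refine Option.ext fun r => ?_
  rw [outcome_eq_some_iff, outcome_eq_some_iff]
  refine ⟨fun ⟨t, ht⟩ => ⟨t, ?_⟩, fun ⟨t, ht⟩ => ⟨t + 1, ?_⟩⟩
  · have := outcomeWithin_succ ht
    rwa [outcomeWithin, if_neg hw] at this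
  · rwa [outcomeWithin, if_neg hw]

lemma measurable_outcomeWithin {d : ℕ} (N t h : ℕ) (w : Vertex d) :
    Measurable (outcomeWithin N t h w : (ℕ → Instruction d) → Outcome d) := by
  induction t generalizing h w with
  | zero => exact measurable_const
  | succ t ih =>
    by_cases hw : w.length = N
    · simp only [outcomeWithin, if_pos hw]
      exact measurable_const
    · simp only [outcomeWithin, if_neg hw]
      have h1 : Measurable fun q : Instruction d × (ℕ → Instruction d) =>
          outcomeWithin N t (min h (step w q.1).length) (step w q.1) q.2 :=
        measurable_from_prod_countable_right fun a =>
          ih (min h (step w a).length) (step w a)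
      exact h1.comp (f := fun η : ℕ → Instruction d => (η 0, fun k => η (k + 1)))
        (by fun_prop)

/-- Outcomes form a countable set, so fibres suffice: that of `some r` is a union over time
horizons, and that of `none` is the complement of all these. -/
lemma measurable_outcome {d : ℕ} (N h : ℕ) (w : Vertex d) :
    Measurable (outcome N h w : (ℕ → Instruction d) → Outcome d) := by
  have hs : ∀ r : ℕ × Vertex d, MeasurableSet ((outcome N h w : _ → Outcome d) ⁻¹' {some r}) := by
    intro r
    have : (outcome N h w : _ → Outcome d) ⁻¹' {some r} =
        ⋃ t, outcomeWithin N t h w ⁻¹' {some r} := by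
      ext η
      simp [outcome_eq_some_iff]
    rw [this]
    exact .iUnion fun t => measurable_outcomeWithin N t h w trivial
  refine measurable_to_countable' fun x => ?_
  cases x with
  | some r => exact hs r
  | none =>
    have : (outcome N h w : _ → Outcome d) ⁻¹' {none} =
        (⋃ r, (outcome N h w : _ → Outcome d) ⁻¹' {some r})ᶜ := by
      ext η
      cases H : outcome N h w η <;> simp [H]
    rw [this]
    exact (MeasurableSet.iUnion hs).compl

/-! ### First step analysis and harmonic functions -/

/-- The law of the instructions of one frog. -/
noncomputable abbrev frogLaw (d : ℕ) [NeZero d] (p : unitInterval) :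
    Measure (ℕ → Instruction d) :=
  Measure.infinitePi fun _ => instructionLaw d p

/-- A sequence of independent instructions is a first instruction followed by an independent such
sequence. -/
lemma map_cons_infinitePi {α : Type*} [MeasurableSpace α] (μ : Measure α)
    [IsProbabilityMeasure μ] :
    (μ.prod (Measure.infinitePi fun _ : ℕ => μ)).map
      (fun q n => Nat.casesOn n q.1 q.2 : α × (ℕ → α) → ℕ → α) =
    Measure.infinitePi fun _ : ℕ => μ := by
  classical
  have hm : Measurable (fun q n => Nat.casesOn n q.1 q.2 : α × (ℕ → α) → ℕ → α) := by
    refine measurable_pi_lambda _ fun n => ?_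
    cases n with
    | zero => exact measurable_fst
    | succ n => exact (measurable_pi_apply n).comp measurable_snd
  refine Measure.eq_infinitePi _ fun s t ht => ?_
  rw [Measure.map_apply hm (.pi s.countable_toSet fun i _ => ht i)]
  have hpre : (fun q n => Nat.casesOn n q.1 q.2 : α × (ℕ → α) → ℕ → α) ⁻¹' (Set.pi s t) =
      (if 0 ∈ s then t 0 else Set.univ) ×ˢ
        Set.pi (s.preimage Nat.succ Nat.succ_injective.injOn) fun n => t (n + 1) := by
    ext ⟨a, η⟩
    simp only [Set.mem_preimage, Set.mem_pi, Finset.mem_coe, Set.mem_prod, Finset.mem_preimage]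
    constructor
    · intro h
      refine ⟨?_, fun n hn => h (n + 1) hn⟩
      split_ifs with h0
      · exact h 0 h0
      · trivial
    · rintro ⟨h0, h1⟩ n hn
      cases n with
      | zero => simpa [hn] using h0
      | succ n => exact h1 n hn
  rw [hpre, Measure.prod_prod, Measure.infinitePi_pi _ fun i _ => ht (i + 1)]
  have h1 := Finset.prod_preimage Nat.succ s Nat.succ_injective.injOn
    (fun n => if n = 0 then 1 else μ (t n)) (by
      intro x _ hx
      cases x with
      | zero => simp
      | succ n => exact (hx ⟨n, rfl⟩).elim)
  simp only [Nat.succ_eq_add_one, Nat.add_eq_zero_iff, one_ne_zero, and_false, if_false] at h1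
  rw [h1]
  by_cases h0 : 0 ∈ s
  · rw [if_pos h0, ← Finset.mul_prod_erase s _ h0, ← Finset.mul_prod_erase s (fun n => μ (t n)) h0]
    simp only [if_true, one_mul]
    congr 1
    exact Finset.prod_congr rfl fun n hn => if_neg (Finset.ne_of_mem_erase hn)
  · rw [if_neg h0, measure_univ, one_mul]
    exact Finset.prod_congr rfl fun n hn => if_neg fun h => h0 (by rwa [h] at hn)

lemma integral_instructionLaw {d : ℕ} [NeZero d] (p : unitInterval) (f : Instruction d → ℝ) :
    ∫ a, f a ∂instructionLaw d p =
      (∑ i, (p * f (true, i) + (1 - p) * f (false, i))) / d := by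
  have h : ∀ b, ∫ i, f (b, i) ∂(PMF.uniformOfFintype (Fin d)).toMeasure = (∑ i, f (b, i)) / d := by
    intro b
    rw [PMF.integral_eq_sum]
    simp [Finset.mul_sum, div_eq_inv_mul]
  rw [instructionLaw, integral_prod _ (.of_finite), integral_bernoulliMeasure]
  simp only [h, smul_eq_mul, Finset.sum_add_distrib, ← Finset.mul_sum]
  ring

/-- The mean of a function of the outcome of the walk from `w`. -/
noncomputable def mean {d : ℕ} [NeZero d] (p : unitInterval) (N h : ℕ) (w : Vertex d)
    (φ : Outcome d → ℝ) : ℝ :=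
  ∫ η, φ (outcome N h w η) ∂frogLaw d p

lemma mean_of_length_eq {d N h : ℕ} [NeZero d] {p : unitInterval} {w : Vertex d}
    {φ : Outcome d → ℝ} (hw : w.length = N) : mean p N h w φ = φ (some (h, w)) := by
  simp [mean, outcome_of_length_eq hw]

/-- First step analysis. -/
lemma mean_of_length_ne {d N h : ℕ} [NeZero d] {p : unitInterval} {w : Vertex d}
    {φ : Outcome d → ℝ} (hφ : ∀ x, φ x ∈ Set.Icc (0 : ℝ) 1) (hw : w.length ≠ N) :
    mean p N h w φ =
      ∫ a, mean p N (min h (step w a).length) (step w a) φ ∂instructionLaw d p := by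
  have hφm : Measurable φ := .of_discrete
  have hm : Measurable fun η => φ (outcome N h w η) := hφm.comp (measurable_outcome N h w)
  have hc : Measurable (fun q n => Nat.casesOn n q.1 q.2 :
      Instruction d × (ℕ → Instruction d) → ℕ → Instruction d) := by
    refine measurable_pi_lambda _ fun n => ?_
    cases n with
    | zero => exact measurable_fst
    | succ n => exact (measurable_pi_apply n).comp measurable_snd
  rw [mean, frogLaw, ← map_cons_infinitePi, integral_map hc.aemeasurable
    hm.aestronglyMeasurable, integral_prod]
  · refine integral_congr_ae (.of_forall fun a => ?_)
    simp only [mean]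
    refine integral_congr_ae (.of_forall fun η => ?_)
    exact congrArg φ (outcome_of_length_ne hw)
  · refine Integrable.of_bound (hm.comp hc).aestronglyMeasurable 1 (.of_forall fun q => ?_)
    simp only [Real.norm_eq_abs]
    rw [abs_of_nonneg (hφ _).1]
    exact (hφ _).2

/-- The drift `2 / 5`. -/
noncomputable def drift : unitInterval := ⟨2 / 5, by norm_num, by norm_num⟩

lemma integral_step {d : ℕ} [NeZero d] (f : Vertex d → ℝ) {w : Vertex d} (hw : w ≠ []) :
    ∫ a, f (step w a) ∂instructionLaw d drift =
      (2 * f w.tail + 3 * ((∑ i, f (i :: w)) / d)) / 5 := by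
  have hd : (d : ℝ) ≠ 0 := NeZero.ne _
  rw [integral_instructionLaw]
  simp only [step, drift, hw, ne_eq, not_false_eq_true, and_true, if_true, and_false,
    Bool.false_eq_true, if_false, Finset.sum_add_distrib, Finset.sum_const, Finset.card_univ,
    Fintype.card_fin, ← Finset.mul_sum, nsmul_eq_mul]
  field_simp
  ring

/-- Inserting the values at the children into the mean value equation at `v` leaves a linear
equation for `F v`; the recursion of `ruinProb` is its solution. The children may have different
boundary values `κ i`. -/
lemma harmonic_top {d n : ℕ} [NeZero d] {F : Vertex d → ℝ} {v : Vertex d} {κ : Fin d → ℝ}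
    (hv : F v = (2 * F v.tail + 3 * ((∑ i, F (i :: v)) / d)) / 5)
    (hκ : ∀ i, F (i :: v) = ruinProb n * F v + (1 - ruinProb n) * κ i) :
    F v = ruinProb (n + 1) * F v.tail + (1 - ruinProb (n + 1)) * ((∑ i, κ i) / d) := by
  have hd : (d : ℝ) ≠ 0 := NeZero.ne _
  have h := ruinProb_succ_mul n
  have hn := ruinProb_mem n
  have h0 : 5 - 3 * ruinProb n ≠ 0 := by linarith
  have hsum : (∑ i, F (i :: v)) / d = ruinProb n * F v + (1 - ruinProb n) * ((∑ i, κ i) / d) := by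
    simp only [hκ, Finset.sum_add_distrib, Finset.sum_const, Finset.card_univ, Fintype.card_fin,
      ← Finset.mul_sum, nsmul_eq_mul]
    field_simp
  rw [hsum] at hv
  refine mul_right_cancel₀ h0 ?_
  linear_combination 5 * hv - (F v.tail - (∑ i, κ i) / d) * h

/-- The optional stopping theorem for a harmonic function that is constant on level `N`. -/
lemma harmonic_strip {d N n : ℕ} [NeZero d] {F : Vertex d → ℝ} {c : Vertex d} {κ : ℝ}
    (hc : c.length + n = N)
    (hF : ∀ w, c <:+ w → w.length ≠ N →
      F w = (2 * F w.tail + 3 * ((∑ i, F (i :: w)) / d)) / 5)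
    (hκ : ∀ w, c <:+ w → w.length = N → F w = κ) :
    F c = ruinProb n * F c.tail + (1 - ruinProb n) * κ := by
  have hd : (d : ℝ) ≠ 0 := NeZero.ne _
  induction n generalizing c with
  | zero => simp [ruinProb, hκ c (List.suffix_refl c) (by omega)]
  | succ n ih =>
    have := harmonic_top (κ := fun _ => κ) (n := n) (hF c (List.suffix_refl c) (by omega))
      fun i => ?_
    · simpa [hd] using this
    · have hs : ∀ w, i :: c <:+ w → c <:+ w := fun w hw => (List.suffix_cons i c).trans hw
      exact ih (c := i :: c) (by simp; omega) (fun w hw => hF w (hs w hw))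
        fun w hw => hκ w (hs w hw)

/-- The mean over a walk from `v` if `φ` depends for walks that stay below `v` only on the
child of `v` that they end up below. -/
lemma mean_eq {d N n : ℕ} [NeZero d] {v : Vertex d} {φ : Outcome d → ℝ} {κ : Fin d → ℝ}
    (hφ : ∀ x, φ x ∈ Set.Icc (0 : ℝ) 1) (hv : v ≠ []) (hn : v.length + (n + 1) = N)
    (hκ : ∀ i z, i :: v <:+ z → z.length = N → φ (some (v.length, z)) = κ i) :
    mean drift N v.length v φ = ruinProb (n + 1) * mean drift N v.tail.length v.tail φ +
      (1 - ruinProb (n + 1)) * ((∑ i, κ i) / d) := by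
  -- The running minimum is a function of the position as long as the walk from `v` has not gone
  -- above `v.tail`: it is `v.length` below `v` and drops by one at `v.tail`. This makes `F`
  -- harmonic below `v`.
  set F : Vertex d → ℝ := fun w => mean drift N (min v.length w.length) w φ with hF
  have hlen : ∀ w, v <:+ w → v.length ≤ w.length := fun w h => h.length_le
  have hne : ∀ w, v <:+ w → w ≠ [] := by
    rintro w h rfl
    exact hv (List.suffix_nil.1 h)
  have hharm : ∀ w, v <:+ w → w.length ≠ N →
      F w = (2 * F w.tail + 3 * ((∑ i, F (i :: w)) / d)) / 5 := by
    intro w hw hwN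
    rw [← integral_step F (hne w hw)]
    simp only [hF]
    rw [mean_of_length_ne hφ hwN, min_eq_left (hlen w hw)]
  have h1 : F v = mean drift N v.length v φ := by simp [hF]
  have h2 : F v.tail = mean drift N v.tail.length v.tail φ := by simp [hF]
  rw [← h1, ← h2]
  refine harmonic_top (hharm v (List.suffix_refl v) (by omega)) fun i => ?_
  have hs : ∀ w, i :: v <:+ w → v <:+ w := fun w hw => (List.suffix_cons i v).trans hw
  refine harmonic_strip (c := i :: v) (by simp; omega) (fun w hw => hharm w (hs w hw)) ?_
  intro w hw hwN
  simp only [hF]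
  rw [mean_of_length_eq hwN, min_eq_left (hlen w (hs w hw)), hκ i w hw hwN]

/-- The probability `F` of never hitting level `N` is harmonic and vanishes on that level. From a
child of the root it is `ruinProb n * F []`, and the root always moves to a child, so `F [] =
ruinProb n * F []` with `ruinProb n < 1`. -/
lemma ae_outcome_ne_none {d N : ℕ} [NeZero d] (hN : 0 < N) :
    ∀ᵐ η ∂frogLaw d drift, outcome N 0 [] η ≠ none := by
  classical
  obtain ⟨n, rfl⟩ := Nat.exists_eq_add_of_le' hN
  set φ : Outcome d → ℝ := fun x => if x = none then 1 else 0 with hφd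
  have hφ : ∀ x, φ x ∈ Set.Icc (0 : ℝ) 1 := by
    intro x
    simp only [hφd]
    split_ifs <;> simp
  have hd : (d : ℝ) ≠ 0 := NeZero.ne _
  set F : Vertex d → ℝ := fun w => mean drift (n + 1) 0 w φ with hF
  have hstep : ∀ w : Vertex d, w.length ≠ n + 1 →
      F w = ∫ a, F (step w a) ∂instructionLaw d drift := by
    intro w hw
    simp only [hF]
    rw [mean_of_length_ne hφ hw]
    simp
  have hchild : ∀ i : Fin d, F [i] = ruinProb n * F [] := by
    intro i
    have := harmonic_strip (F := F) (N := n + 1) (n := n) (c := [i]) (κ := 0) (by simp; omega)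
      (fun w hw hwN => ?_) (fun w _ hwN => ?_)
    · simpa using this
    · rw [hstep w hwN, integral_step F]
      rintro rfl
      simp at hw
    · simp only [hF]
      rw [mean_of_length_eq hwN]
      simp [hφd]
  have hroot : F [] = ruinProb n * F [] := by
    conv_lhs => rw [hstep [] (by simp), integral_instructionLaw]
    simp only [step, ne_eq, not_true_eq_false, false_and, if_false, hchild, Finset.sum_const,
      Finset.card_univ, Fintype.card_fin, nsmul_eq_mul]
    field_simp
    ring
  have h0 : F [] = 0 := by
    have := ruinProb_mem n
    have h : (1 - ruinProb n) * F [] = 0 := by linarith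
    rcases mul_eq_zero.1 h with h | h
    · linarith
    · exact h
  have hm := measurable_outcome (n + 1) 0 ([] : Vertex d)
  have hφm : Measurable φ := .of_discrete
  have hi : Integrable (fun η => φ (outcome (n + 1) 0 [] η)) (frogLaw d drift) := by
    refine Integrable.of_bound (hφm.comp hm).aestronglyMeasurable 1 (.of_forall fun η => ?_)
    rw [Real.norm_eq_abs, abs_of_nonneg (hφ _).1]
    exact (hφ _).2
  have := (integral_eq_zero_iff_of_nonneg (fun η => (hφ _).1) hi).1 h0
  filter_upwards [this] with η hη hnone
  simp [hφd, hnone] at hη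

/-! ### Independence of the outcomes of different frogs -/

/-- The outcome of the frog from `w`. -/
noncomputable def frogOutcome {d : ℕ} (N : ℕ) (w : Vertex d) (ω : Environment d) : Outcome d :=
  outcome N w.length w fun k => ω (w, k)

lemma measurable_frogOutcome {d : ℕ} (N : ℕ) (w : Vertex d) :
    Measurable (frogOutcome N w : Environment d → Outcome d) :=
  (measurable_outcome N w.length w).comp (by fun_prop)

lemma map_environmentLaw {d : ℕ} [NeZero d] (p : unitInterval) (w : Vertex d) :
    (environmentLaw d p).map (fun ω k => ω (w, k)) = frogLaw d p :=
  Measure.map_infinitePi_infinitePi_of_inj (f := fun k : ℕ => (w, k))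
    (P := fun _ : Vertex d × ℕ => instructionLaw d p) (Prod.mk_right_injective w)

lemma iIndepFun_frogOutcome {d : ℕ} [NeZero d] (p : unitInterval) (N : ℕ) :
    iIndepFun (frogOutcome N : Vertex d → Environment d → Outcome d) (environmentLaw d p) := by
  have h : iIndepFun (fun (w : Vertex d) (ω : Environment d) (k : ℕ) => ω (w, k))
      (environmentLaw d p) := by
    rw [iIndepFun_iff_map_fun_eq_infinitePi_map (by fun_prop)]
    simp only [map_environmentLaw]
    exact Measure.infinitePi_map_curry fun (_ : Vertex d) (_ : ℕ) => instructionLaw d p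
  exact h.comp (fun w η => outcome N w.length w η) fun w => measurable_outcome N w.length w

lemma integral_frogOutcome {d : ℕ} [NeZero d] (p : unitInterval) (N : ℕ) (w : Vertex d)
    (φ : Outcome d → ℝ) :
    ∫ ω, φ (frogOutcome N w ω) ∂environmentLaw d p = mean p N w.length w φ := by
  have hφm : Measurable φ := .of_discrete
  rw [mean, ← map_environmentLaw p w, integral_map]
  · rfl
  · exact (by fun_prop : Measurable fun (ω : Environment d) (k : ℕ) => ω (w, k)).aemeasurable
  · exact (hφm.comp (measurable_outcome N w.length w)).aestronglyMeasurable

section Independence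

/-- Factoring through finitely many coordinates makes measurability automatic when `O` is countable
and discrete. The value `default` off `S` is immaterial. -/
lemma exists_eq_of_dependsOn {ι O : Type*} [Inhabited O] {F : (ι → O) → ℝ} {S : Finset ι}
    (hF : DependsOn F S) :
    ∃ g : (S → O) → ℝ, ∀ x, F x = g fun i => x i := by
  classical
  refine ⟨fun y => F fun i => if h : i ∈ S then y ⟨i, h⟩ else default, fun x => hF fun i hi => ?_⟩
  rw [dif_pos (Finset.mem_coe.1 hi)]

variable {Ω ι O : Type*} [MeasurableSpace Ω] [MeasurableSpace O] [DiscreteMeasurableSpace O]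
  [Countable O] [Inhabited O] {μ : Measure Ω} {X : ι → Ω → O}

lemma measurable_of_dependsOn (hX : ∀ i, Measurable (X i)) {F : (ι → O) → ℝ} {S : Finset ι}
    (hF : DependsOn F S) : Measurable fun ω => F fun i => X i ω := by
  obtain ⟨g, hg⟩ := exists_eq_of_dependsOn hF
  simp only [hg]
  exact (Measurable.of_discrete (f := g)).comp (measurable_pi_lambda _ fun i => hX i)

lemma integrable_of_dependsOn [IsProbabilityMeasure μ] (hX : ∀ i, Measurable (X i))
    {F : (ι → O) → ℝ} {S : Finset ι} (hF : DependsOn F S) (hF' : ∀ x, F x ∈ Set.Icc (0 : ℝ) 1) :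
    Integrable (fun ω => F fun i => X i ω) μ := by
  refine Integrable.of_bound (measurable_of_dependsOn hX hF).aestronglyMeasurable 1
    (.of_forall fun ω => ?_)
  rw [Real.norm_eq_abs, abs_of_nonneg (hF' _).1]
  exact (hF' _).2

lemma integral_mul_of_dependsOn (hX : ∀ i, Measurable (X i)) (hind : iIndepFun X μ)
    {F G : (ι → O) → ℝ} {S T : Finset ι} (hF : DependsOn F S) (hG : DependsOn G T)
    (hST : Disjoint S T) :
    ∫ ω, (F fun i => X i ω) * (G fun i => X i ω) ∂μ =
      (∫ ω, F fun i => X i ω ∂μ) * ∫ ω, G fun i => X i ω ∂μ := by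
  have hFm := measurable_of_dependsOn hX hF
  have hGm := measurable_of_dependsOn hX hG
  obtain ⟨f, hf⟩ := exists_eq_of_dependsOn hF
  obtain ⟨g, hg⟩ := exists_eq_of_dependsOn hG
  simp only [hf, hg] at hFm hGm ⊢
  exact ((hind.indepFun_finset S T hST hX).comp (Measurable.of_discrete (f := f))
    (Measurable.of_discrete (f := g))).integral_fun_mul_eq_mul_integral
    hFm.aestronglyMeasurable hGm.aestronglyMeasurable

end Independence

/-! ### Subtrees and the activated frogs -/

/-- The first `n` levels of the subtree below `v`. -/
def subtree {d : ℕ} : ℕ → Vertex d → Finset (Vertex d)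
  | 0, _ => ∅
  | n + 1, v => insert v (Finset.univ.biUnion fun i => subtree n (i :: v))

lemma suffix_of_mem_subtree {d n : ℕ} {v w : Vertex d} (h : w ∈ subtree n v) : v <:+ w := by
  induction n generalizing v with
  | zero => simp [subtree] at h
  | succ n ih =>
    rw [subtree, Finset.mem_insert, Finset.mem_biUnion] at h
    rcases h with rfl | ⟨i, -, h⟩
    · exact List.suffix_refl _
    · exact (List.suffix_cons i v).trans (ih h)

lemma notMem_subtree_of_length_lt {d n : ℕ} {v w : Vertex d} (h : w.length < v.length) :
    w ∉ subtree n v := fun hw => by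
  have := (suffix_of_mem_subtree hw).length_le
  omega

lemma disjoint_subtree {d n m : ℕ} {v w : Vertex d} (hvw : v ≠ w) (hl : v.length = w.length) :
    Disjoint (subtree n v) (subtree m w) := by
  refine Finset.disjoint_left.2 fun y hy hy' => hvw ?_
  exact (List.suffix_of_suffix_length_le (suffix_of_mem_subtree hy) (suffix_of_mem_subtree hy')
    hl.le).eq_of_length hl

lemma exists_drop_eq_cons {d n : ℕ} {z : Vertex d} (h : n < z.length) :
    ∃ i, z.drop n = i :: z.drop (n + 1) :=
  ⟨_, List.drop_eq_getElem_cons h⟩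

lemma subtree_drop_subset {d n : ℕ} {z : Vertex d} (h : n < z.length) :
    subtree n (z.drop n) ⊆ subtree (n + 1) (z.drop (n + 1)) := by
  obtain ⟨i, hi⟩ := exists_drop_eq_cons h
  rw [subtree, hi]
  exact (Finset.subset_biUnion_of_mem (fun i => subtree n (i :: z.drop (n + 1)))
    (Finset.mem_univ i)).trans (Finset.subset_insert _ _)

/-- The outcome `x` tells that the walk ends up in `z'`, stays in the subtree below the ancestor of
`z` that is `n + 1` levels above `z`, and ends up below another child of that ancestor than `z`. -/
def Branches {d : ℕ} (n : ℕ) (z : Vertex d) (x : Outcome d) (z' : Vertex d) : Prop :=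
  x = some ((z.drop (n + 1)).length, z') ∧ z'.length = z.length ∧
    z'.drop (n + 1) = z.drop (n + 1) ∧ z'.drop n ≠ z.drop n

open Classical in
/-- Some element that satisfies `P`, if there is one. -/
noncomputable def pick {α : Type*} (P : α → Prop) : Option α :=
  if h : ∃ z, P z then some h.choose else none

lemma pick_spec {α : Type*} {P : α → Prop} {z : α} (h : pick P = some z) : P z := by
  unfold pick at h
  split_ifs at h with h'
  rw [← Option.some_inj.1 h]
  exact h'.choose_spec

lemma pick_eq_none {α : Type*} {P : α → Prop} : pick P = none ↔ ∀ z, ¬ P z := by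
  unfold pick
  split_ifs with h <;> simpa using h

/-- Sites of frogs that are woken, by frogs of the same subtree, once some frog has walked from the
ancestor of `z` that is `n` levels above `z` down to `z`: we follow the path to `z`, and at each of
its vertices at most one frog into a second child. -/
noncomputable def activated {d : ℕ} : ℕ → Vertex d → (Vertex d → Outcome d) → Finset (Vertex d)
  | 0, _, _ => ∅
  | n + 1, z, σ =>
    insert (z.drop (n + 1)) (activated n z σ) ∪
      (pick fun z' => ∃ w ∈ insert (z.drop (n + 1)) (activated n z σ),
        Branches n z (σ w) z').elim ∅ fun z' => activated n z' σ

lemma activated_subset {d n : ℕ} {z : Vertex d} {σ : Vertex d → Outcome d} (h : n ≤ z.length) :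
    activated n z σ ⊆ subtree n (z.drop n) := by
  induction n generalizing z with
  | zero => simp [activated]
  | succ n ih =>
    rw [activated]
    refine Finset.union_subset (Finset.insert_subset (by simp [subtree])
      ((ih (by omega)).trans (subtree_drop_subset h))) ?_
    cases hp : pick fun z' => ∃ w ∈ insert (z.drop (n + 1)) (activated n z σ),
        Branches n z (σ w) z' with
    | none => simp
    | some z' =>
      obtain ⟨w, -, -, hl, hd, -⟩ := pick_spec hp
      rw [Option.elim_some, ← hd]
      exact (ih (by omega)).trans (subtree_drop_subset (by omega))

/-- The exploration never consults a frog outside the subtree. The arbitrary choice in `pick` is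
harmless because it is a function of the predicate, which is the same for `σ` and `σ'`. -/
lemma activated_congr {d n : ℕ} {z : Vertex d} {σ σ' : Vertex d → Outcome d} (h : n ≤ z.length)
    (hσ : ∀ w ∈ subtree n (z.drop n), σ w = σ' w) : activated n z σ = activated n z σ' := by
  induction n generalizing z with
  | zero => rfl
  | succ n ih =>
    have h1 : activated n z σ = activated n z σ' :=
      ih (by omega) fun w hw => hσ w (subtree_drop_subset h hw)
    have h2 : ∀ w ∈ insert (z.drop (n + 1)) (activated n z σ'), σ w = σ' w := by
      refine fun w hw => hσ w ?_
      rcases Finset.mem_insert.1 hw with rfl | hw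
      · simp [subtree]
      · exact subtree_drop_subset h (activated_subset (by omega) hw)
    have h3 : (fun z' => ∃ w ∈ insert (z.drop (n + 1)) (activated n z σ'), Branches n z (σ w) z') =
        fun z' => ∃ w ∈ insert (z.drop (n + 1)) (activated n z σ'), Branches n z (σ' w) z' := by
      funext z'
      refine propext (exists_congr fun w => and_congr_right fun hw => ?_)
      rw [h2 w hw]
    rw [activated, activated, h1, h3]
    cases hp : pick fun z' => ∃ w ∈ insert (z.drop (n + 1)) (activated n z σ'),
        Branches n z (σ' w) z' with
    | none => rfl
    | some z' =>
      obtain ⟨w, -, -, hl, hd, -⟩ := pick_spec hp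
      rw [Option.elim_some, Option.elim_some, ih (z := z') (by omega)]
      intro w hw
      refine hσ w ?_
      rw [← hd]
      exact subtree_drop_subset (by omega) hw

/-- `φ` restricted to the walks that leave the subtree below `v`. -/
def leaving {d : ℕ} (v : Vertex d) (φ : Outcome d → ℝ) (x : Outcome d) : ℝ :=
  x.elim 1 fun r => if r.1 < v.length then φ x else 1

lemma leaving_mem {d : ℕ} {v : Vertex d} {φ : Outcome d → ℝ}
    (hφ : ∀ x, φ x ∈ Set.Icc (0 : ℝ) 1) (x : Outcome d) : leaving v φ x ∈ Set.Icc (0 : ℝ) 1 := by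
  cases x with
  | none => simp [leaving]
  | some r =>
    simp only [leaving, Option.elim_some]
    split_ifs
    · exact hφ _
    · simp

/-- The product of `φ` over the activated frogs that leave the subtree. -/
noncomputable def leavingProd {d : ℕ} (n : ℕ) (z : Vertex d) (φ : Outcome d → ℝ)
    (σ : Vertex d → Outcome d) : ℝ :=
  ∏ w ∈ activated n z σ, leaving (z.drop n) φ (σ w)

lemma prod_mem_Icc {α : Type*} {s : Finset α} {f : α → ℝ} (h : ∀ x, f x ∈ Set.Icc (0 : ℝ) 1) :
    ∏ x ∈ s, f x ∈ Set.Icc (0 : ℝ) 1 :=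
  ⟨Finset.prod_nonneg fun x _ => (h x).1, Finset.prod_le_one (fun x _ => (h x).1) fun x _ => (h x).2⟩

lemma leavingProd_mem {d n : ℕ} {z : Vertex d} {φ : Outcome d → ℝ}
    (hφ : ∀ x, φ x ∈ Set.Icc (0 : ℝ) 1) (σ : Vertex d → Outcome d) :
    leavingProd n z φ σ ∈ Set.Icc (0 : ℝ) 1 :=
  prod_mem_Icc fun w => leaving_mem hφ (σ w)

lemma dependsOn_leavingProd {d n : ℕ} {z : Vertex d} (h : n ≤ z.length) (φ : Outcome d → ℝ) :
    DependsOn (leavingProd n z φ) (subtree n (z.drop n)) := by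
  intro σ σ' hσ
  unfold leavingProd
  rw [activated_congr h fun w hw => hσ w hw]
  exact Finset.prod_congr rfl fun w hw => by rw [hσ w (activated_subset h hw)]

lemma outcomeWithin_le {d N t h : ℕ} {w : Vertex d} {η : ℕ → Instruction d} {r : ℕ × Vertex d}
    (hr : outcomeWithin N t h w η = some r) : r.1 ≤ h := by
  induction t generalizing h w η with
  | zero => simp [outcomeWithin] at hr
  | succ t ih =>
    rw [outcomeWithin] at hr
    split_ifs at hr
    · rw [← Option.some_inj.1 hr]
    · exact (ih hr).trans (min_le_left _ _)

lemma outcome_le {d N h : ℕ} {w : Vertex d} {η : ℕ → Instruction d} {r : ℕ × Vertex d}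
    (hr : outcome N h w η = some r) : r.1 ≤ h := by
  obtain ⟨t, ht⟩ := outcome_eq_some_iff.1 hr
  exact outcomeWithin_le ht

lemma mean_congr {d N h : ℕ} [NeZero d] {p : unitInterval} {w : Vertex d} {φ ψ : Outcome d → ℝ}
    (hn : φ none = ψ none) (hs : ∀ r : ℕ × Vertex d, r.1 ≤ h → φ (some r) = ψ (some r)) :
    mean p N h w φ = mean p N h w ψ := by
  refine integral_congr_ae (.of_forall fun η => ?_)
  change φ (outcome N h w η) = ψ (outcome N h w η)
  cases hr : outcome N h w η with
  | none => exact hn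
  | some r => exact hs r (outcome_le hr)

lemma mean_mem {d N h : ℕ} [NeZero d] {p : unitInterval} {w : Vertex d} {φ : Outcome d → ℝ}
    (hφ : ∀ x, φ x ∈ Set.Icc (0 : ℝ) 1) : mean p N h w φ ∈ Set.Icc (0 : ℝ) 1 := by
  refine ⟨integral_nonneg fun η => (hφ _).1, ?_⟩
  have hφm : Measurable φ := .of_discrete
  have hi : Integrable (fun η => φ (outcome N h w η)) (frogLaw d p) := by
    refine Integrable.of_bound (hφm.comp (measurable_outcome N h w)).aestronglyMeasurable 1
      (.of_forall fun η => ?_)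
    rw [Real.norm_eq_abs, abs_of_nonneg (hφ _).1]
    exact (hφ _).2
  refine (integral_mono hi (integrable_const 1) fun η => (hφ _).2).trans ?_
  simp

/-! ### Decomposition at the top vertex of a subtree -/

section Recursion

variable {d n : ℕ} {z : Vertex d} {φ χ : Outcome d → ℝ}

/-- The frogs that are activated without the help of a second child. -/
noncomputable def firstActivated (n : ℕ) (z : Vertex d) (σ : Vertex d → Outcome d) :
    Finset (Vertex d) :=
  insert (z.drop (n + 1)) (activated n z σ)

/-- The end of the walk that enters a second child. -/
noncomputable def branch (n : ℕ) (z : Vertex d) (σ : Vertex d → Outcome d) :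
    Option (Vertex d) :=
  pick fun z' => ∃ w ∈ firstActivated n z σ, Branches n z (σ w) z'

lemma activated_succ (σ : Vertex d → Outcome d) :
    activated (n + 1) z σ =
      firstActivated n z σ ∪ (branch n z σ).elim ∅ fun z' => activated n z' σ := rfl

lemma firstActivated_subset (h : n < z.length) (σ : Vertex d → Outcome d) :
    firstActivated n z σ ⊆ insert (z.drop (n + 1)) (subtree n (z.drop n)) :=
  Finset.insert_subset_insert _ (activated_subset h.le)

lemma firstActivated_congr (h : n < z.length) {σ σ' : Vertex d → Outcome d}
    (hσ : ∀ w ∈ insert (z.drop (n + 1)) (subtree n (z.drop n)), σ w = σ' w) :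
    firstActivated n z σ = firstActivated n z σ' := by
  rw [firstActivated, firstActivated,
    activated_congr h.le fun w hw => hσ w (Finset.mem_insert_of_mem hw)]

lemma branch_congr (h : n < z.length) {σ σ' : Vertex d → Outcome d}
    (hσ : ∀ w ∈ insert (z.drop (n + 1)) (subtree n (z.drop n)), σ w = σ' w) :
    branch n z σ = branch n z σ' := by
  rw [branch, branch, firstActivated_congr h hσ]
  congr 1
  funext z'
  refine propext (exists_congr fun w => and_congr_right fun hw => ?_)
  rw [hσ w (firstActivated_subset h σ' hw)]

lemma drop_notMem_subtree (h : n < z.length) : z.drop (n + 1) ∉ subtree n (z.drop n) :=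
  notMem_subtree_of_length_lt (by simp; omega)

lemma prod_firstActivated (h : n < z.length) (hχ : leaving (z.drop n) χ = χ)
    (σ : Vertex d → Outcome d) :
    ∏ w ∈ firstActivated n z σ, χ (σ w) = χ (σ (z.drop (n + 1))) * leavingProd n z χ σ := by
  rw [firstActivated, Finset.prod_insert fun hw =>
    drop_notMem_subtree h (activated_subset h.le hw), leavingProd, hχ]

/-- Going above the larger subtree entails going above the smaller one. -/
lemma leaving_leaving (h : n < z.length) :
    leaving (z.drop n) (leaving (z.drop (n + 1)) φ) = leaving (z.drop (n + 1)) φ := by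
  funext x
  cases x with
  | none => rfl
  | some r =>
    simp only [leaving, Option.elim_some, List.length_drop]
    split_ifs <;> first | rfl | omega

open Classical in
/-- `leaving φ` on the walks that do not enter a second child, and zero on those that do. -/
noncomputable def notBranching (n : ℕ) (z : Vertex d) (φ : Outcome d → ℝ) (x : Outcome d) : ℝ :=
  if ∃ z', Branches n z x z' then 0 else leaving (z.drop (n + 1)) φ x

lemma notBranching_mem (hφ : ∀ x, φ x ∈ Set.Icc (0 : ℝ) 1) (x : Outcome d) :
    notBranching n z φ x ∈ Set.Icc (0 : ℝ) 1 := by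
  unfold notBranching
  split_ifs
  · simp
  · exact leaving_mem hφ x

lemma notBranching_none : notBranching n z φ none = 1 := by
  simp [notBranching, Branches, leaving]

/-- Both a branching walk and a walk that leaves the larger subtree reach level `z.length - (n + 1)`
or above, hence leave the smaller subtree. So the induction hypothesis can be applied to
`notBranching`. -/
lemma leaving_notBranching (h : n < z.length) :
    leaving (z.drop n) (notBranching n z φ) = notBranching n z φ := by
  funext x
  cases x with
  | none => rw [notBranching_none]; rfl
  | some r =>
    by_cases hr : r.1 < (z.drop n).length
    · simp only [leaving, Option.elim_some, if_pos hr]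
    · have h1 : ¬ ∃ z', Branches n z (some r) z' := by
        rintro ⟨z', h1, -⟩
        rw [← Option.some_inj.1 h1.symm] at hr
        simp at hr
        omega
      rw [notBranching, if_neg h1]
      simp only [leaving, Option.elim_some, if_neg hr]
      rw [if_neg]
      simp at hr ⊢
      omega

/-- The ends of walks that enter a second child. -/
noncomputable def branchEnds (n : ℕ) (z : Vertex d) : Finset (Vertex d) :=
  ((List.finite_length_eq (Fin d) z.length).subset
    (t := {z' | z'.length = z.length ∧ z'.drop (n + 1) = z.drop (n + 1) ∧ z'.drop n ≠ z.drop n})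
    fun _ h => h.1).toFinset

lemma mem_branchEnds {z' : Vertex d} : z' ∈ branchEnds n z ↔
    z'.length = z.length ∧ z'.drop (n + 1) = z.drop (n + 1) ∧ z'.drop n ≠ z.drop n := by
  simp [branchEnds]

lemma branch_mem {σ : Vertex d → Outcome d} {z' : Vertex d} (h : branch n z σ = some z') :
    z' ∈ branchEnds n z := by
  obtain ⟨w, -, -, h⟩ := pick_spec h
  exact mem_branchEnds.2 h

open Classical in
/-- The product over the frogs that are activated without the help of a second child, if the walk
that enters the second child ends in `z'`. -/
noncomputable def branchProd (n : ℕ) (z : Vertex d) (φ : Outcome d → ℝ) (z' : Vertex d)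
    (σ : Vertex d → Outcome d) : ℝ :=
  if branch n z σ = some z' then
    ∏ w ∈ firstActivated n z σ, leaving (z.drop (n + 1)) φ (σ w) else 0

/-- The absence of a branching frog is itself a product event, absorbed here by the zero value of
`notBranching`. This keeps the expectation within reach of the induction hypothesis. -/
lemma prod_notBranching (σ : Vertex d → Outcome d) :
    ∏ w ∈ firstActivated n z σ, notBranching n z φ (σ w) =
      if branch n z σ = none then
        ∏ w ∈ firstActivated n z σ, leaving (z.drop (n + 1)) φ (σ w) else 0 := by
  split_ifs with h
  · refine Finset.prod_congr rfl fun w hw => if_neg ?_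
    rintro ⟨z', hz'⟩
    exact pick_eq_none.1 h z' ⟨w, hw, hz'⟩
  · obtain ⟨z', hz'⟩ := Option.ne_none_iff_exists'.1 h
    obtain ⟨w, hw, hb⟩ := pick_spec hz'
    exact Finset.prod_eq_zero hw (if_pos ⟨z', hb⟩)

lemma sum_branchProd (σ : Vertex d → Outcome d) :
    ∏ w ∈ firstActivated n z σ, leaving (z.drop (n + 1)) φ (σ w) =
      ∏ w ∈ firstActivated n z σ, notBranching n z φ (σ w) +
        ∑ z' ∈ branchEnds n z, branchProd n z φ z' σ := by
  rw [prod_notBranching]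
  cases h : branch n z σ with
  | none => simp [branchProd, h]
  | some z' =>
    simp only [branchProd, h, reduceCtorEq, if_false, zero_add, Option.some_inj]
    rw [Finset.sum_ite_eq, if_pos (branch_mem h)]

/-- Summing over the end `z'` of the branching walk makes the second subtree deterministic in each
term. The two factors then depend on disjoint sets of frogs. -/
lemma leavingProd_succ (h : n < z.length) (σ : Vertex d → Outcome d) :
    leavingProd (n + 1) z φ σ =
      ∏ w ∈ firstActivated n z σ, notBranching n z φ (σ w) +
        ∑ z' ∈ branchEnds n z, branchProd n z φ z' σ *
          leavingProd n z' (leaving (z.drop (n + 1)) φ) σ := by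
  rw [prod_notBranching, leavingProd, activated_succ]
  cases hb : branch n z σ with
  | none => simp [branchProd, hb]
  | some z' =>
    obtain ⟨h1, h2, h3⟩ := mem_branchEnds.1 (branch_mem hb)
    have hn' : n < z'.length := h1 ▸ h
    simp only [branchProd, hb, reduceCtorEq, if_false, zero_add, Option.some_inj, ite_mul, zero_mul]
    rw [Finset.sum_ite_eq, if_pos (branch_mem hb), Option.elim_some, Finset.prod_union, leavingProd,
      ← h2, leaving_leaving hn']
    refine Finset.disjoint_of_subset_left (firstActivated_subset h σ)
      (Finset.disjoint_of_subset_right (activated_subset hn'.le) ?_)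
    rw [Finset.disjoint_insert_left, ← h2]
    exact ⟨drop_notMem_subtree hn', disjoint_subtree h3.symm (by simp [h1])⟩

lemma dependsOn_branchProd (h : n < z.length) (z' : Vertex d) :
    DependsOn (branchProd n z φ z') (insert (z.drop (n + 1)) (subtree n (z.drop n)) : Finset _) := by
  intro σ σ' hσ
  have hσ' : ∀ w ∈ insert (z.drop (n + 1)) (subtree n (z.drop n)), σ w = σ' w :=
    fun w hw => hσ w (Finset.mem_coe.2 hw)
  rw [branchProd, branchProd, branch_congr h hσ', firstActivated_congr h hσ']
  congr 1
  exact Finset.prod_congr rfl fun w hw => by rw [hσ' w (firstActivated_subset h σ' hw)]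

lemma dependsOn_prod_firstActivated (h : n < z.length) :
    DependsOn (fun σ => ∏ w ∈ firstActivated n z σ, χ (σ w))
      (insert (z.drop (n + 1)) (subtree n (z.drop n)) : Finset _) := by
  intro σ σ' hσ
  have hσ' : ∀ w ∈ insert (z.drop (n + 1)) (subtree n (z.drop n)), σ w = σ' w :=
    fun w hw => hσ w (Finset.mem_coe.2 hw)
  change ∏ w ∈ firstActivated n z σ, χ (σ w) = ∏ w ∈ firstActivated n z σ', χ (σ' w)
  rw [firstActivated_congr h hσ']
  exact Finset.prod_congr rfl fun w hw => by rw [hσ' w (firstActivated_subset h σ' hw)]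

lemma branchProd_mem (hφ : ∀ x, φ x ∈ Set.Icc (0 : ℝ) 1) (z' : Vertex d)
    (σ : Vertex d → Outcome d) : branchProd n z φ z' σ ∈ Set.Icc (0 : ℝ) 1 := by
  unfold branchProd
  split_ifs
  · exact prod_mem_Icc fun w => leaving_mem hφ (σ w)
  · simp

end Recursion

/-! ### The recursive bound in expectation -/

section Expectation

variable {d N n : ℕ} [NeZero d] {z : Vertex d} {φ χ : Outcome d → ℝ}

/-- The mean of a function of the outcomes of all frogs. -/
noncomputable def expect (N : ℕ) (F : (Vertex d → Outcome d) → ℝ) : ℝ :=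
  ∫ ω, F (fun w => frogOutcome N w ω) ∂environmentLaw d drift

lemma integral_prod_firstActivated (h : n < z.length) (hχ : leaving (z.drop n) χ = χ) :
    expect N (fun σ => ∏ w ∈ firstActivated n z σ, χ (σ w)) =
      mean drift N (z.drop (n + 1)).length (z.drop (n + 1)) χ * expect N (leavingProd n z χ) := by
  rw [← integral_frogOutcome]
  simp only [expect, prod_firstActivated h hχ]
  refine integral_mul_of_dependsOn (X := frogOutcome N) (fun w => measurable_frogOutcome N w)
    (iIndepFun_frogOutcome drift N) (F := fun σ => χ (σ (z.drop (n + 1)))) (G := leavingProd n z χ)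
    (S := {z.drop (n + 1)}) (T := subtree n (z.drop n)) ?_ (dependsOn_leavingProd h.le χ)
    (Finset.disjoint_singleton_left.2 (drop_notMem_subtree h))
  intro σ σ' hσ
  change χ _ = χ _
  rw [hσ _ (by simp)]

lemma mean_leaving (h : n + 1 < N) (hz : z.length = N) (hφ : ∀ x, φ x ∈ Set.Icc (0 : ℝ) 1)
    (hφ' : φ none = 1) :
    mean drift N (z.drop (n + 1)).length (z.drop (n + 1)) (leaving (z.drop (n + 1)) φ) =
      ruinProb (n + 1) * mean drift N (z.drop (n + 2)).length (z.drop (n + 2)) φ +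
        (1 - ruinProb (n + 1)) := by
  have hd : (d : ℝ) ≠ 0 := NeZero.ne _
  have hv : z.drop (n + 1) ≠ [] := by simp; omega
  rw [mean_eq (n := n) (κ := fun _ => 1) (leaving_mem hφ) hv (by simp; omega) (by simp [leaving])]
  simp only [List.tail_drop, Finset.sum_const, Finset.card_univ, Fintype.card_fin, nsmul_eq_mul,
    mul_one, div_self hd]
  rw [mean_congr (ψ := φ) (by simp [leaving, hφ'])]
  intro r hr
  simp only [leaving, Option.elim_some]
  rw [if_pos]
  simp at hr ⊢
  omega

/-- A walk that stays below the top vertex contributes `1` only if it ends below the child leading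
to `z`, which is one child among `d`. -/
lemma mean_notBranching (h : n + 1 < N) (hz : z.length = N) (hφ : ∀ x, φ x ∈ Set.Icc (0 : ℝ) 1)
    (hφ' : φ none = 1) :
    mean drift N (z.drop (n + 1)).length (z.drop (n + 1)) (notBranching n z φ) =
      ruinProb (n + 1) * mean drift N (z.drop (n + 2)).length (z.drop (n + 2)) φ +
        (1 - ruinProb (n + 1)) * (1 / d) := by
  classical
  have hv : z.drop (n + 1) ≠ [] := by simp; omega
  obtain ⟨j, hj⟩ := exists_drop_eq_cons (z := z) (n := n) (by omega)
  rw [mean_eq (n := n) (κ := fun i => if i = j then 1 else 0) (notBranching_mem hφ) hv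
    (by simp; omega)]
  · simp only [List.tail_drop, Finset.sum_ite_eq', Finset.mem_univ, if_true]
    rw [mean_congr (ψ := φ) (by simp [notBranching_none, hφ'])]
    intro r hr
    have h1 : r.1 < (z.drop (n + 1)).length := by simp at hr ⊢; omega
    rw [notBranching, if_neg]
    · simp only [leaving, Option.elim_some, if_pos h1]
    · rintro ⟨z', hb, -⟩
      rw [← Option.some_inj.1 hb.symm] at h1
      simp at h1
  · intro i z' hi hz'
    have h1 : i :: z.drop (n + 1) = z'.drop n := by
      rw [List.suffix_iff_eq_drop] at hi
      rw [hi]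
      congr 1
      simp
      omega
    have h2 : z'.drop (n + 1) = z.drop (n + 1) := by
      rw [← List.tail_drop, ← h1, List.tail_cons]
    have h3 : (∃ y, Branches n z (some ((z.drop (n + 1)).length, z')) y) ↔ i ≠ j := by
      constructor
      · rintro ⟨y, hy, -, -, hne⟩ rfl
        rw [← (Prod.mk.inj (Option.some_inj.1 hy)).2] at hne
        exact hne (h1.symm.trans hj.symm)
      · intro hij
        refine ⟨z', rfl, by omega, h2, fun he => hij ?_⟩
        rw [← h1, hj] at he
        exact (List.cons.inj he).1
    rw [notBranching]
    by_cases hij : i = j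
    · rw [if_neg (fun h => h3.1 h hij), if_pos hij]
      simp [leaving]
    · rw [if_pos (h3.2 hij), if_neg hij]

/-- The recursive bound for the generating function of the number of frogs that leave a subtree. -/
theorem integral_leavingProd_le (hd : 2 ≤ d) (hn : n < N) (hz : z.length = N)
    (hφ : ∀ x, φ x ∈ Set.Icc (0 : ℝ) 1) (hφ' : φ none = 1) :
    expect N (leavingProd n z φ) ≤
      genBound (rate n) (mean drift N (z.drop (n + 1)).length (z.drop (n + 1)) φ) := by
  have hX : ∀ w, Measurable (frogOutcome N w : Environment d → Outcome d) :=
    fun w => measurable_frogOutcome N w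
  induction n generalizing z φ with
  | zero => simp [expect, leavingProd, activated, rate, genBound]
  | succ n ih =>
    have hnz : n < z.length := by omega
    have hl := rate_nonneg n
    set v := z.drop (n + 1) with hv
    set a := mean drift N v.length v (notBranching n z φ) with ha
    set b := mean drift N v.length v (leaving v φ) with hb
    have ha1 := mean_mem (p := drift) (N := N) (h := v.length) (w := v)
      (notBranching_mem (n := n) (z := z) hφ)
    have hb1 := mean_mem (p := drift) (N := N) (h := v.length) (w := v) (leaving_mem (v := v) hφ)
    rw [← ha] at ha1
    rw [← hb] at hb1
    set g := genBound (rate n) b with hg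
    have hP : expect N (fun σ => ∏ w ∈ firstActivated n z σ, notBranching n z φ (σ w)) ≤
        a * genBound (rate n) a := by
      rw [integral_prod_firstActivated hnz (leaving_notBranching hnz)]
      exact mul_le_mul_of_nonneg_left
        (ih (by omega) hz (notBranching_mem hφ) notBranching_none) ha1.1
    have hQ : expect N (fun σ => ∏ w ∈ firstActivated n z σ, leaving v φ (σ w)) ≤ b * g := by
      rw [integral_prod_firstActivated hnz (leaving_leaving hnz)]
      exact mul_le_mul_of_nonneg_left (ih (by omega) hz (leaving_mem hφ) rfl) hb1.1
    have hi1 : Integrable (fun ω => ∏ w ∈ firstActivated n z fun w => frogOutcome N w ω,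
        notBranching n z φ (frogOutcome N w ω)) (environmentLaw d drift) :=
      integrable_of_dependsOn hX (dependsOn_prod_firstActivated hnz)
        fun σ => prod_mem_Icc fun w => notBranching_mem hφ (σ w)
    have hi2 : ∀ z', Integrable (fun ω => branchProd n z φ z' fun w => frogOutcome N w ω)
        (environmentLaw d drift) := fun z' =>
      integrable_of_dependsOn hX (dependsOn_branchProd hnz z') (branchProd_mem hφ z')
    have hmul : ∀ z' ∈ branchEnds n z,
        expect N (fun σ => branchProd n z φ z' σ * leavingProd n z' (leaving v φ) σ) =
          expect N (branchProd n z φ z') * expect N (leavingProd n z' (leaving v φ)) := by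
      intro z' hz'
      obtain ⟨h1, h2, h3⟩ := mem_branchEnds.1 hz'
      have hn' : n < z'.length := by omega
      refine integral_mul_of_dependsOn hX (iIndepFun_frogOutcome drift N)
        (dependsOn_branchProd hnz z') (dependsOn_leavingProd hn'.le _) ?_
      rw [Finset.disjoint_insert_left, ← h2]
      exact ⟨drop_notMem_subtree hn', disjoint_subtree h3.symm (by simp [h1])⟩
    have hi3 : ∀ z' ∈ branchEnds n z, Integrable (fun ω => branchProd n z φ z'
        (fun w => frogOutcome N w ω) * leavingProd n z' (leaving v φ) fun w => frogOutcome N w ω)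
        (environmentLaw d drift) := by
      intro z' hz'
      obtain ⟨h1, h2, h3⟩ := mem_branchEnds.1 hz'
      have hn' : n < z'.length := by omega
      have hm1 := measurable_of_dependsOn hX (dependsOn_branchProd (φ := φ) hnz z')
      have hm2 := measurable_of_dependsOn hX (dependsOn_leavingProd hn'.le (leaving v φ))
      refine Integrable.of_bound (hm1.mul hm2).aestronglyMeasurable 1 (.of_forall fun ω => ?_)
      have hu1 := branchProd_mem (n := n) (z := z) hφ z' fun w => frogOutcome N w ω
      have hu2 := leavingProd_mem (n := n) (z := z') (leaving_mem (v := v) hφ)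
        fun w => frogOutcome N w ω
      rw [Real.norm_eq_abs, abs_of_nonneg (mul_nonneg hu1.1 hu2.1)]
      exact mul_le_one₀ hu1.2 hu2.1 hu2.2
    have hsum : expect N (fun σ => ∏ w ∈ firstActivated n z σ, leaving v φ (σ w)) =
        expect N (fun σ => ∏ w ∈ firstActivated n z σ, notBranching n z φ (σ w)) +
          ∑ z' ∈ branchEnds n z, expect N (branchProd n z φ z') := by
      simp only [expect, hv, sum_branchProd]
      rw [integral_add hi1 (integrable_finsetSum _ fun z' _ => hi2 z'),
        integral_finsetSum _ fun z' _ => hi2 z']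
    have hmain : expect N (leavingProd (n + 1) z φ) =
        expect N (fun σ => ∏ w ∈ firstActivated n z σ, notBranching n z φ (σ w)) +
          ∑ z' ∈ branchEnds n z,
            expect N (branchProd n z φ z') * expect N (leavingProd n z' (leaving v φ)) := by
      simp only [expect, leavingProd_succ hnz]
      rw [integral_add hi1 (integrable_finsetSum _ hi3), integral_finsetSum _ hi3]
      congr 1
      exact Finset.sum_congr rfl hmul
    have hle : ∑ z' ∈ branchEnds n z,
        expect N (branchProd n z φ z') * expect N (leavingProd n z' (leaving v φ)) ≤
          (∑ z' ∈ branchEnds n z, expect N (branchProd n z φ z')) * g := by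
      rw [Finset.sum_mul]
      refine Finset.sum_le_sum fun z' hz' => mul_le_mul_of_nonneg_left ?_
        (integral_nonneg fun ω => (branchProd_mem hφ z' _).1)
      obtain ⟨h1, h2, h3⟩ := mem_branchEnds.1 hz'
      -- The second subtree hangs from the same vertex `v`, so its bound is again `g`.
      have := ih (z := z') (φ := leaving v φ) (by omega) (by omega) (leaving_mem hφ) rfl
      rwa [h2] at this
    have hg1 : g ≤ 1 := genBound_le_one hl hb1.2
    have hg0 : 0 < g := genBound_pos hl hb1.2
    set m := mean drift N (z.drop (n + 1 + 1)).length (z.drop (n + 1 + 1)) φ with hm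
    have hm1 := mean_mem (p := drift) (N := N) (h := (z.drop (n + 1 + 1)).length)
      (w := z.drop (n + 1 + 1)) hφ
    rw [← hm] at hm1
    have hea : a = ruinProb (n + 1) * m + (1 - ruinProb (n + 1)) * (1 / d) :=
      mean_notBranching hn hz hφ hφ'
    have heb : b = ruinProb (n + 1) * m + (1 - ruinProb (n + 1)) := mean_leaving hn hz hφ hφ'
    have hd' : (2 : ℝ) ≤ d := by exact_mod_cast hd
    have hstep := genBound_step (κ := 1 / d) n (by positivity)
      (one_div_le_one_div_of_le (by norm_num) hd') hm1.1 hm1.2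
    rw [← hea, ← heb, ← hg] at hstep
    rw [hmain]
    -- With `P` and `Q` the expectations in `hP` and `hQ`, the sum of the `branchProd` terms is `Q -
    -- P`. The total is thus at most `P + (Q - P) * g = P * (1 - g) + Q * g`, the form treated in
    -- `genBound_step`.
    nlinarith [mul_le_mul_of_nonneg_right hP (sub_nonneg.2 hg1),
      mul_le_mul_of_nonneg_right hQ hg0.le]

end Expectation

/-! ### From outcomes back to the frog dynamics -/

/-- On a tree a walk cannot skip vertices of the geodesic. Here `m` is the lowest level of the walk
itself, and the common ancestor `s` is carried for the induction: if the walk stays strictly below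
`w` after its first step, `s` shows that `w` is an ancestor of `z`. -/
lemma exists_path_eq {d N t h h' : ℕ} {w z : Vertex d} {η : ℕ → Instruction d}
    (hh : h ≤ w.length) (hr : outcomeWithin N t h w η = some (h', z)) :
    z.length = N ∧ ∃ m, h' = min h m ∧ m ≤ w.length ∧
      (∃ s, s.length = m ∧ s <:+ w ∧ s <:+ z) ∧
      ∀ y, m ≤ y.length → y <:+ w ∨ y <:+ z → ∃ k, path η w k = y := by
  induction t generalizing h w η with
  | zero => simp [outcomeWithin] at hr
  | succ t ih =>
    rw [outcomeWithin] at hr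
    split_ifs at hr with hw
    · obtain ⟨rfl, rfl⟩ := Prod.mk.inj (Option.some_inj.1 hr)
      refine ⟨hw, w.length, (min_eq_left hh).symm, le_rfl,
        ⟨w, rfl, List.suffix_refl w, List.suffix_refl w⟩, fun y hy hs => ⟨0, ?_⟩⟩
      rw [or_self] at hs
      exact (hs.eq_of_length (le_antisymm hs.length_le hy)).symm
    · obtain ⟨hz, m, hm, hmw, ⟨s, hs, hsw, hsz⟩, hpath⟩ := ih (min_le_right _ _) hr
      have hpath' : ∀ y, m ≤ y.length → y <:+ step w (η 0) ∨ y <:+ z → ∃ k, path η w k = y := by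
        intro y hy hys
        obtain ⟨k, hk⟩ := hpath y hy hys
        exact ⟨k + 1, by rw [← path_shift, hk]⟩
      refine ⟨hz, min w.length m, by omega, min_le_left _ _, ?_⟩
      unfold step at hpath' hmw hsw
      split_ifs at hpath' hmw hsw with hstep
      · have hlen : w.tail.length < w.length := by
          rw [List.length_tail]
          have := List.length_pos_iff.2 hstep.1
          omega
        rw [min_eq_right (by omega)]
        refine ⟨⟨s, hs, hsw.trans (List.tail_suffix w), hsz⟩, fun y hy hys => ?_⟩
        rcases hys with hys | hys
        · obtain ⟨a, w', rfl⟩ := List.exists_cons_of_ne_nil hstep.1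
          rcases List.suffix_cons_iff.1 hys with rfl | hys
          · exact ⟨0, rfl⟩
          · exact hpath' y hy (.inl hys)
        · exact hpath' y hy (.inr hys)
      · rw [List.length_cons] at hmw
        rcases Nat.lt_or_ge w.length m with hlt | hge
        · rw [min_eq_left hlt.le]
          have hs' := hsw.eq_of_length (by simp; omega)
          have hwz : w <:+ z := (List.suffix_cons (η 0).2 w).trans (hs' ▸ hsz)
          refine ⟨⟨w, rfl, List.suffix_refl w, hwz⟩, fun y hy hys => ?_⟩
          rcases hys with hys | hys
          · exact ⟨0, (hys.eq_of_length (le_antisymm hys.length_le hy)).symm⟩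
          · rcases hy.eq_or_lt with hy | hy
            · exact ⟨0, (List.suffix_of_suffix_length_le hwz hys hy.le).eq_of_length hy⟩
            · exact hpath' y (by omega) (.inr hys)
        · rw [min_eq_right hge]
          refine ⟨⟨s, hs, List.suffix_of_suffix_length_le hsw (List.suffix_cons _ _) (by omega),
            hsz⟩, fun y hy hys => hpath' y hy ?_⟩
          exact hys.imp_left fun h => h.trans (List.suffix_cons _ _)

/-- A frog visits the path from its initial vertex to the highest vertex of its walk, and the path
from there to the end of its walk. -/
lemma exists_walk_eq {d N h : ℕ} {w z : Vertex d} {ω : Environment d}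
    (hr : frogOutcome N w ω = some (h, z)) :
    z.length = N ∧ ∀ y, h ≤ y.length → y <:+ w ∨ y <:+ z → ∃ k, walk ω w k = y := by
  obtain ⟨t, ht⟩ := outcome_eq_some_iff.1 hr
  obtain ⟨hz, m, rfl, hm, -, hpath⟩ := exists_path_eq le_rfl ht
  refine ⟨hz, fun y hy hys => ?_⟩
  obtain ⟨k, hk⟩ := hpath y (by omega) hys
  exact ⟨k, by rw [walk_eq_path, hk]⟩

/-- The frog from `v` wakes up at some time. -/
def Awake {d : ℕ} (ω : Environment d) (v : Vertex d) : Prop := ∃ t k, age ω t v = some k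

lemma age_succ_of_some {d t k : ℕ} {ω : Environment d} {v : Vertex d} (h : age ω t v = some k) :
    age ω (t + 1) v = some (k + 1) := by
  rw [age, h]

lemma exists_age_eq_zero {d t k : ℕ} {ω : Environment d} {v : Vertex d}
    (h : age ω t v = some k) : ∃ s, age ω s v = some 0 := by
  induction t generalizing k with
  | zero =>
    refine ⟨0, ?_⟩
    rw [age] at h ⊢
    split_ifs at h ⊢
    rfl
  | succ t ih =>
    cases h' : age ω t v with
    | some j => exact ih h'
    | none =>
      refine ⟨t + 1, ?_⟩
      rw [age, h'] at h ⊢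
      dsimp only at h ⊢
      split_ifs at h ⊢
      rfl

lemma Awake.exists_age_eq {d : ℕ} {ω : Environment d} {v : Vertex d} (h : Awake ω v) (k : ℕ) :
    ∃ t, age ω t v = some k := by
  obtain ⟨t, j, h⟩ := h
  induction k with
  | zero => exact exists_age_eq_zero h
  | succ k ih =>
    obtain ⟨t, ht⟩ := ih
    exact ⟨t + 1, age_succ_of_some ht⟩

lemma awake_root {d : ℕ} (ω : Environment d) : Awake ω [] := ⟨0, 0, by simp [age]⟩

lemma Awake.of_walk {d k : ℕ} {ω : Environment d} {u v : Vertex d} (h : Awake ω u)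
    (hk : walk ω u k = v) : Awake ω v := by
  cases k with
  | zero => exact hk ▸ h
  | succ k =>
    obtain ⟨t, ht⟩ := h.exists_age_eq k
    cases hv : age ω t v with
    | some j => exact ⟨t, j, hv⟩
    | none =>
      refine ⟨t + 1, 0, ?_⟩
      rw [age, hv]
      exact if_pos ⟨u, k, ht, hk⟩

/-- One visit per frog is enough: distinct frogs give distinct pairs. -/
lemma card_le_rootVisits {d : ℕ} {ω : Environment d} {s : Finset (Vertex d)}
    (hs : ∀ w ∈ s, Awake ω w ∧ ∃ k, walk ω w k = []) : (s.card : ℕ∞) ≤ rootVisits ω := by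
  have h : ∀ w, ∃ t, w ∈ s → ∃ k, age ω t w = some k ∧ walk ω w k = [] := by
    intro w
    by_cases hw : w ∈ s
    · obtain ⟨ha, k, hk⟩ := hs w hw
      obtain ⟨t, ht⟩ := ha.exists_age_eq k
      exact ⟨t, fun _ => ⟨k, ht, hk⟩⟩
    · exact ⟨0, fun h => (hw h).elim⟩
  choose t ht using h
  have hinj : Function.Injective fun w => (w, t w) := fun a b hab => (Prod.mk.inj hab).1
  rw [← Set.encard_coe_eq_coe_finsetCard, ← hinj.injOn.encard_image, rootVisits]
  refine Set.encard_le_encard ?_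
  rintro _ ⟨w, hw, rfl⟩
  exact ht w hw

/-- A branching frog visits every vertex from the top vertex down to the end `z'` of its walk, so
these vertices are awake and the induction applies to `z'` as it does to `z`. -/
lemma awake_of_mem_activated {d n N : ℕ} {z w : Vertex d} {ω : Environment d}
    (hn : n ≤ z.length) (hz : ∀ y, z.length ≤ y.length + n → y <:+ z → Awake ω y)
    (hw : w ∈ activated n z fun v => frogOutcome N v ω) : Awake ω w := by
  induction n generalizing z w with
  | zero => simp [activated] at hw
  | succ n ih =>
    have hfirst : ∀ w ∈ firstActivated n z fun v => frogOutcome N v ω, Awake ω w := by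
      intro w hw
      rcases Finset.mem_insert.1 hw with rfl | hw
      · exact hz _ (by simp; omega) (List.drop_suffix _ _)
      · exact ih (by omega) (fun y hy => hz y (by omega)) hw
    rw [activated_succ] at hw
    rcases Finset.mem_union.1 hw with hw | hw
    · exact hfirst w hw
    · cases hb : branch n z fun v => frogOutcome N v ω with
      | none => simp [hb] at hw
      | some z' =>
        rw [hb, Option.elim_some] at hw
        obtain ⟨u, hu, hout, hlen, -, -⟩ := pick_spec hb
        refine ih (by omega) (fun y hy hyz => ?_) hw
        obtain ⟨k, hk⟩ := (exists_walk_eq hout).2 y (by simp; omega) (.inr hyz)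
        exact (hfirst u hu).of_walk hk

/-! ### Counting root visits and conclusion -/

/-- The weight of a frog: `1 / 2` if it visits the root. -/
noncomputable def rootWeight {d : ℕ} (x : Outcome d) : ℝ :=
  x.elim 1 fun r => if r.1 = 0 then 1 / 2 else 1

lemma rootWeight_mem {d : ℕ} (x : Outcome d) : rootWeight x ∈ Set.Icc (0 : ℝ) 1 := by
  cases x with
  | none => simp [rootWeight]
  | some r =>
    simp only [rootWeight, Option.elim_some]
    split_ifs <;> norm_num

/-- Started at the root, the lowest level is `0` from the outset, and the outcome `none` has
probability zero. -/
lemma mean_rootWeight {d N : ℕ} [NeZero d] (hN : 0 < N) :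
    mean drift N 0 ([] : Vertex d) rootWeight = 1 / 2 := by
  have h : ∀ᵐ η ∂frogLaw d drift, rootWeight (outcome N 0 [] η) = 1 / 2 := by
    filter_upwards [ae_outcome_ne_none hN] with η hη
    obtain ⟨r, hr⟩ := Option.ne_none_iff_exists'.1 hη
    have := outcome_le hr
    rw [hr]
    simp only [rootWeight, Option.elim_some]
    rw [if_pos (by omega)]
  rw [mean, integral_congr_ae h]
  simp

lemma leavingProd_rootWeight_ge {d n K : ℕ} {z : Vertex d} {ω : Environment d}
    (hr : frogOutcome (n + 1) [] ω = some (0, z)) (hK : rootVisits ω < K) :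
    (1 / 2 : ℝ) ^ K ≤ leavingProd n z rootWeight fun w => frogOutcome (n + 1) w ω := by
  classical
  obtain ⟨hz, hwalk⟩ := exists_walk_eq hr
  set A := activated n z fun w => frogOutcome (n + 1) w ω with hA
  set s := A.filter fun w => ∃ y, frogOutcome (n + 1) w ω = some (0, y) with hs
  have hcard : s.card < K := by
    have : (s.card : ℕ∞) ≤ rootVisits ω := by
      refine card_le_rootVisits fun w hw => ?_
      obtain ⟨hwA, y, hy⟩ := Finset.mem_filter.1 hw
      refine ⟨awake_of_mem_activated (by omega) (fun y _ hyz => ?_) hwA,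
        (exists_walk_eq hy).2 [] (Nat.zero_le _) (.inl List.nil_suffix)⟩
      obtain ⟨k, hk⟩ := hwalk y (Nat.zero_le _) (.inr hyz)
      exact (awake_root ω).of_walk hk
    exact_mod_cast this.trans_lt hK
  have hprod : leavingProd n z rootWeight (fun w => frogOutcome (n + 1) w ω) =
      ∏ w ∈ A, if ∃ y, frogOutcome (n + 1) w ω = some (0, y) then (1 / 2 : ℝ) else 1 := by
    refine Finset.prod_congr rfl fun w _ => ?_
    change leaving (z.drop n) rootWeight (frogOutcome (n + 1) w ω) = _
    cases hw : frogOutcome (n + 1) w ω with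
    | none => simp [leaving]
    | some r =>
      obtain ⟨h, y⟩ := r
      by_cases h0 : h = 0
      -- The vertex `z.drop n` has level `1`, so a walk that reaches the root does leave the
      -- subtree.
      · simp [leaving, rootWeight, h0]
        omega
      · simp [leaving, rootWeight, h0]
  rw [hprod, ← Finset.prod_filter, Finset.prod_const]
  exact pow_le_pow_of_le_one (by norm_num) (by norm_num) hcard.le

/-- Markov's inequality for `R`, which splits according to the end `z` of the root frog's walk. The
cutoff is `N = n + 1`, so the subtree explored hangs from a child of the root and is independent of
the root frog; a frog that leaves it is at the root, where the mean of `rootWeight` is `1 / 2`. -/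
lemma measure_rootVisits_lt_le {d : ℕ} [NeZero d] (hd : 2 ≤ d) (n K : ℕ) :
    (environmentLaw d drift).real {ω | rootVisits ω < K} ≤
      2 ^ K * genBound (rate n) (1 / 2) := by
  classical
  set μ := environmentLaw d drift with hμ
  set N := n + 1 with hN
  have hX : ∀ w, Measurable (frogOutcome N w : Environment d → Outcome d) :=
    fun w => measurable_frogOutcome N w
  set L : Finset (Vertex d) := (List.finite_length_eq (Fin d) N).toFinset with hL
  have hmemL : ∀ z, z ∈ L ↔ z.length = N := fun z => by simp [hL]
  set ind : Vertex d → Outcome d → ℝ := fun z x => if x = some (0, z) then 1 else 0 with hind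
  have hind01 : ∀ z x, ind z x ∈ Set.Icc (0 : ℝ) 1 := by
    intro z x
    simp only [hind]
    split_ifs <;> simp
  have hdep : ∀ z, DependsOn (fun σ : Vertex d → Outcome d => ind z (σ []))
      (({[]} : Finset (Vertex d)) : Set (Vertex d)) := by
    intro z σ σ' h
    change ind z _ = ind z _
    rw [h [] (by simp)]
  have hi1 : ∀ z, Integrable (fun ω => ind z (frogOutcome N [] ω)) μ := fun z =>
    integrable_of_dependsOn hX (hdep z) fun σ => hind01 z _
  have hi2 : ∀ z ∈ L, Integrable (fun ω => ind z (frogOutcome N [] ω) *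
      leavingProd n z rootWeight fun w => frogOutcome N w ω) μ := by
    intro z hz
    have hn : n ≤ z.length := by rw [(hmemL z).1 hz]; omega
    have hm1 := measurable_of_dependsOn hX (hdep z)
    have hm2 := measurable_of_dependsOn hX (dependsOn_leavingProd hn rootWeight)
    refine Integrable.of_bound (hm1.mul hm2).aestronglyMeasurable 1 (.of_forall fun ω => ?_)
    have hu2 := leavingProd_mem (n := n) (z := z) rootWeight_mem fun w => frogOutcome N w ω
    rw [Real.norm_eq_abs, abs_of_nonneg (mul_nonneg (hind01 _ _).1 hu2.1)]
    exact mul_le_one₀ (hind01 _ _).2 hu2.1 hu2.2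
  set R : Environment d → ℝ := fun ω => ∑ z ∈ L, ind z (frogOutcome N [] ω) *
    leavingProd n z rootWeight fun w => frogOutcome N w ω with hR
  have hR0 : ∀ ω, 0 ≤ R ω := fun ω => Finset.sum_nonneg fun z _ =>
    mul_nonneg (hind01 _ _).1 (leavingProd_mem rootWeight_mem _).1
  have hRi : Integrable R μ := integrable_finsetSum _ hi2
  set g := genBound (rate n) (1 / 2) with hg
  have hg0 : 0 < g := genBound_pos (rate_nonneg n) (by norm_num)
  have hER : ∫ ω, R ω ∂μ ≤ g := by
    calc ∫ ω, R ω ∂μ = ∑ z ∈ L, ∫ ω, ind z (frogOutcome N [] ω) *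
          leavingProd n z rootWeight (fun w => frogOutcome N w ω) ∂μ := integral_finsetSum _ hi2
      _ ≤ ∑ z ∈ L, (∫ ω, ind z (frogOutcome N [] ω) ∂μ) * g := by
        refine Finset.sum_le_sum fun z hz => ?_
        have hzN := (hmemL z).1 hz
        have hn : n ≤ z.length := by omega
        have hdrop : z.drop (n + 1) = [] := List.drop_eq_nil_of_le (by omega)
        have hmul := integral_mul_of_dependsOn (X := frogOutcome N) hX
          (iIndepFun_frogOutcome drift N) (hdep z) (dependsOn_leavingProd hn rootWeight)
          (Finset.disjoint_singleton_left.2 (notMem_subtree_of_length_lt (by simp; omega)))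
        have hle := integral_leavingProd_le hd (by omega : n < N) hzN rootWeight_mem rfl
        rw [hdrop, List.length_nil, mean_rootWeight (by omega)] at hle
        rw [← hμ] at hmul
        rw [hmul]
        exact mul_le_mul_of_nonneg_left hle (integral_nonneg fun ω => (hind01 _ _).1)
      _ = (∫ ω, ∑ z ∈ L, ind z (frogOutcome N [] ω) ∂μ) * g := by
        rw [integral_finsetSum _ fun z _ => hi1 z, Finset.sum_mul]
      _ ≤ 1 * g := by
        refine mul_le_mul_of_nonneg_right ?_ hg0.le
        refine (integral_mono (integrable_finsetSum _ fun z _ => hi1 z) (integrable_const 1)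
          fun ω => ?_).trans (by simp)
        simp only [hind]
        cases hout : frogOutcome N [] ω with
        | none => simp
        | some r =>
          obtain ⟨h, y⟩ := r
          have : ∀ z, (some (h, y) = some (0, z)) ↔ (y = z ∧ h = 0) := by
            intro z
            simp [and_comm]
          simp only [this, ite_and]
          rw [Finset.sum_ite_eq]
          split_ifs <;> simp
      _ = g := one_mul g
  have hae : ∀ᵐ ω ∂μ, frogOutcome N [] ω ≠ none := by
    have hmap := map_environmentLaw (d := d) drift []
    have hm : Measurable fun (ω : Environment d) (k : ℕ) => ω (([] : Vertex d), k) := by fun_prop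
    have := ae_outcome_ne_none (d := d) (N := N) (by omega)
    rw [← hmap] at this
    exact ae_of_ae_map hm.aemeasurable this
  have hsub : ∀ᵐ ω ∂μ, ω ∈ {ω | rootVisits ω < K} → ω ∈ {ω | (1 / 2 : ℝ) ^ K ≤ R ω} := by
    filter_upwards [hae] with ω hω hlt
    obtain ⟨⟨h, z⟩, hr⟩ := Option.ne_none_iff_exists'.1 hω
    obtain rfl : h = 0 := Nat.le_zero.1 (outcome_le hr)
    have hz := (exists_walk_eq hr).1
    have h1 := leavingProd_rootWeight_ge hr hlt
    refine h1.trans ?_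
    have h2 := Finset.single_le_sum (f := fun z => ind z (frogOutcome N [] ω) *
      leavingProd n z rootWeight fun w => frogOutcome N w ω)
      (fun z _ => mul_nonneg (hind01 _ _).1 (leavingProd_mem rootWeight_mem _).1)
      ((hmemL z).2 hz)
    beta_reduce at h2
    rwa [show ind z (frogOutcome N [] ω) = 1 by simp [hind, hr], one_mul] at h2
  have h1 : μ.real {ω | rootVisits ω < K} ≤ μ.real {ω | (1 / 2 : ℝ) ^ K ≤ R ω} :=
    ENNReal.toReal_mono (measure_ne_top _ _) (measure_mono_ae hsub)
  have h2 := mul_meas_ge_le_integral_of_nonneg (.of_forall hR0) hRi ((1 / 2 : ℝ) ^ K)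
  have h3 : (1 / 2 : ℝ) ^ K * μ.real {ω | rootVisits ω < K} ≤ g :=
    (mul_le_mul_of_nonneg_left h1 (by positivity)).trans (h2.trans hER)
  calc μ.real {ω | rootVisits ω < K} =
        2 ^ K * ((1 / 2 : ℝ) ^ K * μ.real {ω | rootVisits ω < K}) := by
        rw [← mul_assoc, ← mul_pow]
        norm_num
    _ ≤ 2 ^ K * g := mul_le_mul_of_nonneg_left h3 (by positivity)

lemma tendsto_genBound_rate :
    Filter.Tendsto (fun n => genBound (rate n) (1 / 2)) Filter.atTop (nhds 0) := by
  unfold genBound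
  refine Filter.Tendsto.inv_tendsto_atTop (Filter.tendsto_atTop_add_const_left _ _
    (Filter.Tendsto.atTop_mul_const (by norm_num) ?_))
  unfold rate
  exact (tendsto_natCast_atTop_atTop.comp (Filter.tendsto_sub_atTop_nat 4)).atTop_div_const
    (by norm_num)

theorem isRecurrent_drift {d : ℕ} [NeZero d] (hd : 2 ≤ d) : IsRecurrent d drift := by
  have h : ∀ K : ℕ, ∀ᵐ ω ∂environmentLaw d drift, (K : ℕ∞) ≤ rootVisits ω := by
    intro K
    have hlim : Filter.Tendsto (fun n => 2 ^ K * genBound (rate n) (1 / 2)) Filter.atTop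
        (nhds 0) := by
      simpa using tendsto_genBound_rate.const_mul (2 ^ K : ℝ)
    have h0 : (environmentLaw d drift).real {ω | rootVisits ω < K} ≤ 0 :=
      ge_of_tendsto' hlim fun n => measure_rootVisits_lt_le hd n K
    have h1 : environmentLaw d drift {ω | rootVisits ω < K} = 0 :=
      (measureReal_eq_zero_iff).1 (le_antisymm h0 measureReal_nonneg)
    rw [ae_iff]
    simpa only [not_le] using h1
  filter_upwards [ae_all_iff.2 h] with ω hω
  exact ENat.eq_top_iff_forall_ge.2 hω

end FrogModel

/-- The first conjunct makes sure that the infimum is not taken over the empty set. -/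
theorem mainTheorem1 (d : ℕ) [NeZero d] (hd : 2 ≤ d) :
    (FrogModel.recurrentDrifts d).Nonempty ∧ FrogModel.criticalDrift d ≤ 0.4155 := by
  have hmem : (2 / 5 : ℝ) ∈ FrogModel.recurrentDrifts d :=
    ⟨FrogModel.drift.2, FrogModel.isRecurrent_drift hd⟩
  refine ⟨⟨_, hmem⟩, (csInf_le ⟨0, ?_⟩ hmem).trans (by norm_num)⟩
  rintro p ⟨hp, -⟩
  exact hp.1
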